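/- Let $\mathbb F$ be a field and $G$ an abelian group. Algebras are vector spaces over $\mathbb F$ with a bilinear multiplication (no associativity, unit or finite dimension is assumed). The centroid of an algebra $\mathcal A$ is $C(\mathcal A)=\{c\in\operatorname{End}_{\mathbb F}(\mathcal A)\mid c(xy)=c(x)y=xc(y)\ \forall x,y\}$, and $\mathcal A$ is central simple if $\mathcal A\neq 0$, $\mathcal A^2=\mathcal A$, its only ideals are $0$ and $\mathcal A$, and $C(\mathcal A)=\mathbb F1$. A $G$-graded algebra $\mathcal B=\bigoplus_{g\in G}\mathcal B_g$ (with $\mathcal B_g\mathcal B_h\subseteq\mathcal B_{gh}$) is graded-central-simple if $\mathcal B\ne 0$, $\mathcal B^2=\mathcal B$, its only graded ideals are $0$ and $\mathcal B$, and the only $c\in C(\mathcal B)$ with $c(\mathcal B_g)\subseteq\mathcal B_g$ for all $g\in G$ are the scalars. Write $\simeq_G$ for isomorphism of $G$-graded algebras (an algebra isomorphism mapping the component of degree $g$ onto the component of degree $g$, for all $g\in G$). For abelian groups $A,B$ let $\mathrm Z^2_{\mathrm{sym}}(A,B)$ be the group of symmetric $2$-cocycles, i.e. maps $\sigma:A\times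 A\to B$ with $\sigma(a,b)\sigma(ab,c)=\sigma(a,bc)\sigma(b,c)$ and $\sigma(a,b)=\sigma(b,a)$, and let $\mathrm H^2_{\mathrm{sym}}(A,B)=\mathrm Z^2_{\mathrm{sym}}(A,B)/\{\mathrm d\gamma\mid\gamma:A\to B\}$, where $\mathrm d\gamma(a,b)=\gamma(a)\gamma(b)\gamma(ab)^{-1}$; for a homomorphism $f:A'\to A$ put $f^*[\sigma]=[\sigma\circ(f\times f)]$. For a $G$-graded algebra $\mathcal A$ and $\tau\in\mathrm Z^2_{\mathrm{sym}}(G,\mathbb F^\times)$, the twist $\mathcal A^\tau$ is the graded vector space $\mathcal A$ with the multiplication $x*y=\tau(g,h)xy$ for $x\in\mathcal A_g$, $y\in\mathcal A_h$. For a subgroup $H\le G$ with projection $\pi:G\to G/H$ and a $G/H$-graded algebra $\mathcal A$, the loop algebra is the $G$-graded subalgebra $L_\pi(\mathcal A)=\bigoplus_{g\in G}\mathcal A_{\pi(g)}\otimes g$ of $\mathcal A\otimes_{\mathbb F}\mathbb FG$, and $L_\pi^\tau(\mathcal A)=(L_\pi(\mathcal A))^\tau$. Let $\overline{\mathfrak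 B}(G,\mathbb F)$ be the set of $\simeq_G$-isomorphism classes $[\mathcal B]$ of $G$-graded-central-simple algebras $\mathcal B$. Let $\overline{\mathfrak A}(G,\mathbb F)$ be the set of equivalence classes of triples $(H,[\tau],\mathcal A)$, where $H$ is a subgroup of $G$, $[\tau]\in\mathrm H^2_{\mathrm{sym}}(G,\mathbb F^\times)$, and $\mathcal A$ is a $G/H$-graded algebra that is central simple as an ungraded algebra, under the equivalence relation: $(H_1,[\tau_1],\mathcal A_1)\sim(H_2,[\tau_2],\mathcal A_2)$ if $H_1=H_2=:H$, $\iota^*[\tau_1]=\iota^*[\tau_2]$ for the inclusion $\iota:H\hookrightarrow G$, and there is $\mu\in\mathrm Z^2_{\mathrm{sym}}(G/H,\mathbb F^\times)$ such that $[\tau_1]=\pi^*([\mu])[\tau_2]$ and $\mathcal A_1^\mu\simeq_{G/H}\mathcal A_2$. Then the map $$\overline{\mathfrak A}(G,\mathbb F)\longrightarrow\overline{\mathfrak B}(G,\mathbb F),\qquad [(H,[\tau],\mathcal A)]\mapsto[L_\pi^\tau(\mathcal A)]$$ is well defined (in particular, $L_\pi^\tau(\mathcal A)$ is $G$-graded-central-simple)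 and is a bijection. -/

import Mathlib

universe u v w

open scoped TensorProduct

noncomputable section

/-! ## Symmetric second cohomology of abelian groups -/

section Cohomology

variable (A B : Type*) [CommGroup A] [CommGroup B]

/-- The group `Z²_sym(A, B)` of symmetric `2`-cocycles (trivial action), under pointwise product. -/
def Z2sym : Subgroup (A → A → B) where
  carrier := {σ | (∀ a b c, σ a b * σ (a * b) c = σ a (b * c) * σ b c) ∧ ∀ a b, σ a b = σ b a}
  one_mem' := by simp
  mul_mem' := by
    rintro σ τ ⟨hσ, hσ'⟩ ⟨hτ, hτ'⟩
    refine ⟨fun a b c => ?_, fun a b => ?_⟩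
    · simp only [Pi.mul_apply]
      rw [mul_mul_mul_comm, hσ, hτ, mul_mul_mul_comm]
    · simp only [Pi.mul_apply, hσ' a b, hτ' a b]
  inv_mem' := by
    rintro σ ⟨hσ, hσ'⟩
    refine ⟨fun a b c => ?_, fun a b => ?_⟩
    · simp only [Pi.inv_apply]
      rw [← mul_inv, ← mul_inv, hσ]
    · simp only [Pi.inv_apply, hσ' a b]

/-- The coboundary map `γ ↦ dγ`, `dγ(a, b) = γ(a) γ(b) γ(ab)⁻¹`. -/
def coboundaryHom : (A → B) →* (A → A → B) where
  toFun γ := fun a b => γ a * γ b * (γ (a * b))⁻¹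
  map_one' := by funext a b; simp
  map_mul' γ δ := by
    funext a b
    simp only [Pi.mul_apply, mul_inv]
    rw [mul_mul_mul_comm (γ a), mul_mul_mul_comm (γ a * γ b)]

/-- The group `B²(A, B)` of `2`-coboundaries. -/
def B2 : Subgroup (A → A → B) := (coboundaryHom A B).range

theorem B2_le_Z2sym : B2 A B ≤ Z2sym A B := by
  rintro _ ⟨γ, rfl⟩
  refine ⟨fun a b c => ?_, fun a b => ?_⟩
  · simp only [coboundaryHom, MonoidHom.coe_mk, OneHom.coe_mk]
    rw [← mul_assoc a b c]
    have e : ∀ {M : Type _} [AddCommGroup M] (p q r s t k : M),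
        p + q + -t + (t + r + -k) = p + s + -k + (q + r + -s) := by
      intros; abel
    exact e (M := Additive B) _ _ _ _ _ _
  · simp only [coboundaryHom, MonoidHom.coe_mk, OneHom.coe_mk]
    rw [mul_comm (γ a), mul_comm a]

/-- `H²_sym(A, B) = Z²_sym(A, B) / B²(A, B)`. -/
def H2sym : Type _ := Z2sym A B ⧸ (B2 A B).subgroupOf (Z2sym A B)

instance : CommGroup (H2sym A B) :=
  inferInstanceAs (CommGroup (Z2sym A B ⧸ (B2 A B).subgroupOf (Z2sym A B)))

variable {A B} in
/-- The class `[τ]` of a symmetric cocycle. -/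
def H2sym.mk : Z2sym A B →* H2sym A B := QuotientGroup.mk' _

variable {A}

/-- Precomposition of a symmetric cocycle with `f × f`. -/
def Z2sym.comap {A' : Type*} [CommGroup A'] (f : A' →* A) : Z2sym A B →* Z2sym A' B where
  toFun σ := ⟨fun a b => σ.1 (f a) (f b), fun a b c => by
      simpa only [map_mul] using σ.2.1 (f a) (f b) (f c), fun a b => σ.2.2 _ _⟩
  map_one' := rfl
  map_mul' _ _ := rfl

/-- The map `f^* : H²_sym(A, B) → H²_sym(A', B)`, `[σ] ↦ [σ ∘ (f × f)]`. -/
def H2sym.pullback {A' : Type*} [CommGroup A'] (f : A' →* A) : H2sym A B →* H2sym A' B :=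
  QuotientGroup.map _ _ (Z2sym.comap B f) (by
    rintro ⟨σ, hσ⟩ ⟨γ, hγ⟩
    refine ⟨fun a => γ (f a), ?_⟩
    change coboundaryHom A B γ = σ at hγ
    subst hγ
    funext a b
    change γ (f a) * γ (f b) * (γ (f (a * b)))⁻¹ = γ (f a) * γ (f b) * (γ (f a * f b))⁻¹
    rw [map_mul])

end Cohomology

/-! ## Graded algebras -/

open scoped Classical in
/-- A `G`-graded algebra over `F`: a vector space with a bilinear multiplication (not necessarily
associative, unital or finite-dimensional) which is the direct sum of subspaces `deg g`, `g ∈ G`,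
such that `deg g * deg h ⊆ deg (g * h)`. -/
structure GradedAlg (F : Type u) [Field F] (G : Type v) [CommGroup G] where
  carrier : Type w
  [addCommGroup : AddCommGroup carrier]
  [module : Module F carrier]
  mul : carrier →ₗ[F] carrier →ₗ[F] carrier
  deg : G → Submodule F carrier
  isInternal : DirectSum.IsInternal deg
  mul_mem : ∀ {g h : G} {x y : carrier}, x ∈ deg g → y ∈ deg h → mul x y ∈ deg (g * h)

attribute [instance] GradedAlg.addCommGroup GradedAlg.module

namespace GradedAlg

variable {F : Type u} [Field F] {G : Type v} [CommGroup G]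

/-- Graded isomorphism `A ≃_G B`. -/
def GradedIso (A B : GradedAlg.{u, v, w} F G) : Prop :=
  ∃ φ : A.carrier ≃ₗ[F] B.carrier,
    (∀ x y, φ (A.mul x y) = B.mul (φ x) (φ y)) ∧
      ∀ g, (A.deg g).map φ.toLinearMap = B.deg g

section Predicates

variable (A : GradedAlg.{u, v, w} F G)

/-- Two-sided ideals. -/
def IsIdeal (I : Submodule F A.carrier) : Prop :=
  ∀ a, ∀ x ∈ I, A.mul a x ∈ I ∧ A.mul x a ∈ I

/-- Graded ideals: ideals `I` with `I = ⊕ (I ∩ A_g)`. -/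
def IsGradedIdeal (I : Submodule F A.carrier) : Prop :=
  A.IsIdeal I ∧ I = ⨆ g, I ⊓ A.deg g

/-- The subspace `A²` spanned by all products. -/
def square : Submodule F A.carrier := Submodule.map₂ A.mul ⊤ ⊤

/-- `A` is simple as an ungraded algebra: `A ≠ 0`, `A² = A`, and the only ideals are `0`, `A`. -/
def IsSimple : Prop :=
  Nontrivial A.carrier ∧ A.square = ⊤ ∧ ∀ I, A.IsIdeal I → I = ⊥ ∨ I = ⊤

/-- `A` is graded-simple: `A ≠ 0`, `A² = A`, and the only graded ideals are `0`, `A`. -/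
def IsGradedSimple : Prop :=
  Nontrivial A.carrier ∧ A.square = ⊤ ∧ ∀ I, A.IsGradedIdeal I → I = ⊥ ∨ I = ⊤

/-- The centroid `C(A)`, a unital subalgebra of `End_F(A)`. -/
def centroid : Subalgebra F (Module.End F A.carrier) where
  carrier := {c | ∀ x y, c (A.mul x y) = A.mul (c x) y ∧ c (A.mul x y) = A.mul x (c y)}
  mul_mem' := by
    intro c d hc hd x y
    simp only [Module.End.mul_apply]
    exact ⟨by rw [(hd x y).1, (hc _ _).1], by rw [(hd x y).2, (hc _ _).2]⟩
  add_mem' := by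
    intro c d hc hd x y
    simp only [LinearMap.add_apply, map_add]
    exact ⟨by rw [(hd x y).1, (hc _ _).1], by rw [(hd x y).2, (hc _ _).2]⟩
  algebraMap_mem' r x y := by simp [Module.algebraMap_end_apply]

/-- The subspace `C(A)_g` of centroid elements that are homogeneous of degree `g`. -/
def centroidDeg (g : G) : Submodule F (Module.End F A.carrier) where
  carrier := {c | c ∈ A.centroid ∧ ∀ g', ∀ x ∈ A.deg g', c x ∈ A.deg (g * g')}
  zero_mem' := ⟨zero_mem _, fun _ _ _ => zero_mem _⟩
  add_mem' := fun hc hd =>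
    ⟨add_mem hc.1 hd.1, fun g' x hx => add_mem (hc.2 g' x hx) (hd.2 g' x hx)⟩
  smul_mem' := fun r _ hc =>
    ⟨A.centroid.smul_mem hc.1 r, fun g' x hx => Submodule.smul_mem _ r (hc.2 g' x hx)⟩

/-- `A` is central simple as an ungraded algebra: simple with `C(A) = F 1`. -/
def IsCentralSimple : Prop :=
  A.IsSimple ∧ Subalgebra.toSubmodule A.centroid = Submodule.span F {1}

/-- `A` is graded-central-simple: graded-simple with `C(A)_e = F 1`. -/
def IsGradedCentralSimple : Prop :=
  A.IsGradedSimple ∧ A.centroidDeg 1 = Submodule.span F {1}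

end Predicates

namespace GradedIso

theorem refl (A : GradedAlg.{u, v, w} F G) : A.GradedIso A :=
  ⟨LinearEquiv.refl F _, fun _ _ => rfl, fun _ => Submodule.map_id _⟩

theorem symm {A B : GradedAlg.{u, v, w} F G} : A.GradedIso B → B.GradedIso A := by
  rintro ⟨φ, hm, hd⟩
  refine ⟨φ.symm, fun x y => ?_, fun g => ?_⟩
  · rw [LinearEquiv.symm_apply_eq, hm, φ.apply_symm_apply, φ.apply_symm_apply]
  · rw [← hd g, ← Submodule.map_comp]
    simp

theorem trans {A B C : GradedAlg.{u, v, w} F G} :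
    A.GradedIso B → B.GradedIso C → A.GradedIso C := by
  rintro ⟨φ, hm, hd⟩ ⟨ψ, hm', hd'⟩
  refine ⟨φ.trans ψ, fun x y => ?_, fun g => ?_⟩
  · simp [hm, hm']
  · rw [← hd' g, ← hd g, ← Submodule.map_comp]
    rfl

end GradedIso

/-! ## Cocycle twists -/

section Twist

variable (A : GradedAlg.{u, v, w} F G)

open scoped Classical in
/-- The isomorphism of `A` with the external direct sum of its homogeneous components. -/
def coords : A.carrier ≃ₗ[F] DirectSum G (fun g => A.deg g) :=
  (LinearEquiv.ofBijective (DirectSum.coeLinearMap A.deg) A.isInternal).symm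

open scoped Classical in
/-- The bilinear map with `(x, y) ↦ τ(g, h) x y` for `x ∈ A_g`, `y ∈ A_h`. -/
def twistMul (τ : G → G → Fˣ) : A.carrier →ₗ[F] A.carrier →ₗ[F] A.carrier :=
  (DirectSum.toModule F G _ fun g =>
    ((DirectSum.toModule F G _ fun h =>
      ((τ g h : F) • A.mul.domRestrict₁₂ (A.deg g) (A.deg h)).flip).comp
        A.coords.toLinearMap).flip).comp A.coords.toLinearMap

theorem twistMul_of_mem (τ : G → G → Fˣ) {g h : G} {x y : A.carrier}
    (hx : x ∈ A.deg g) (hy : y ∈ A.deg h) :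
    A.twistMul τ x y = (τ g h : F) • A.mul x y := by
  classical
  have key : ∀ {g : G} {x : A.carrier} (hx : x ∈ A.deg g),
      A.coords x = DirectSum.lof F G (fun g => A.deg g) g ⟨x, hx⟩ := by
    intro g x hx
    rw [coords, LinearEquiv.symm_apply_eq]
    exact (DirectSum.coeLinearMap_lof A.deg g ⟨x, hx⟩).symm
  simp only [twistMul, LinearMap.comp_apply, LinearEquiv.coe_coe, key hx, key hy,
    DirectSum.toModule_lof, LinearMap.flip_apply, LinearMap.smul_apply]
  rfl

/-- The `τ`-twist `A^τ`: the same graded vector space, with multiplication `twistMul τ`. -/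
def twist (τ : Z2sym G Fˣ) : GradedAlg.{u, v, w} F G where
  carrier := A.carrier
  mul := A.twistMul τ.1
  deg := A.deg
  isInternal := A.isInternal
  mul_mem hx hy := by
    rw [A.twistMul_of_mem τ.1 hx hy]
    exact Submodule.smul_mem _ _ (A.mul_mem hx hy)

/-- Two bilinear maps that agree on homogeneous elements are equal. -/
theorem bilin_ext {V : Type*} [AddCommGroup V] [Module F V]
    {f f' : A.carrier →ₗ[F] A.carrier →ₗ[F] V}
    (hf : ∀ g h, ∀ x ∈ A.deg g, ∀ y ∈ A.deg h, f x y = f' x y) : f = f' := by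
  classical
  have htop : ⨆ g, A.deg g = ⊤ := A.isInternal.submodule_iSup_eq_top
  have hx : ∀ x : A.carrier, x ∈ ⨆ g, A.deg g := fun x => by rw [htop]; trivial
  ext x y
  refine Submodule.iSup_induction A.deg (motive := fun x => f x y = f' x y) (hx x) ?_ (by simp)
    (fun a b ha hb => by simp [ha, hb])
  intro g a ha
  refine Submodule.iSup_induction A.deg (motive := fun y => f a y = f' a y) (hx y) ?_ (by simp)
    (fun b c hb hc => by simp [hb, hc])
  exact fun h b hb => hf g h a ha b hb

end Twist

/-! ## Loop algebras -/

section Loop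

variable {H : Subgroup G} (A : GradedAlg.{u, v, w} F (G ⧸ H))

/-- The multiplication of the algebra `A ⊗ F G`. -/
def tensorMul : A.carrier ⊗[F] MonoidAlgebra F G →ₗ[F]
    A.carrier ⊗[F] MonoidAlgebra F G →ₗ[F] A.carrier ⊗[F] MonoidAlgebra F G :=
  TensorProduct.map₂ A.mul (LinearMap.mul F (MonoidAlgebra F G))

/-- The subspace `A_{π(g)} ⊗ g` of `A ⊗ F G`, where `π : G → G/H`. -/
def loopDeg (g : G) : Submodule F (A.carrier ⊗[F] MonoidAlgebra F G) :=
  (A.deg (QuotientGroup.mk' H g)).map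
    ((TensorProduct.mk F A.carrier (MonoidAlgebra F G)).flip (MonoidAlgebra.of F G g))

/-- The subspace `⊕_g A_{π(g)} ⊗ g` of `A ⊗ F G`. -/
def loopSpace : Submodule F (A.carrier ⊗[F] MonoidAlgebra F G) := ⨆ g, A.loopDeg g

theorem tensorMul_mem_loopDeg {g h : G} {x y : A.carrier ⊗[F] MonoidAlgebra F G}
    (hx : x ∈ A.loopDeg g) (hy : y ∈ A.loopDeg h) : A.tensorMul x y ∈ A.loopDeg (g * h) := by
  obtain ⟨a, ha, rfl⟩ := hx
  obtain ⟨b, hb, rfl⟩ := hy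
  refine ⟨A.mul a b, ?_, ?_⟩
  · rw [map_mul]
    exact A.mul_mem ha hb
  · simp [tensorMul]

theorem tensorMul_mem_loopSpace {x y : A.carrier ⊗[F] MonoidAlgebra F G}
    (hx : x ∈ A.loopSpace) (hy : y ∈ A.loopSpace) : A.tensorMul x y ∈ A.loopSpace := by
  refine Submodule.iSup_induction A.loopDeg (motive := fun x => A.tensorMul x y ∈ A.loopSpace)
    hx ?_ (by simp) (fun a b ha hb => by simpa using add_mem ha hb)
  intro g a ha
  refine Submodule.iSup_induction A.loopDeg (motive := fun y => A.tensorMul a y ∈ A.loopSpace)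
    hy ?_ (by simp) (fun b c hb hc => by simpa using add_mem hb hc)
  exact fun h b hb => Submodule.mem_iSup_of_mem (g * h) (A.tensorMul_mem_loopDeg ha hb)

theorem iSupIndep_loopDeg : iSupIndep A.loopDeg := by
  classical
  let p (g : G) : A.carrier ⊗[F] MonoidAlgebra F G →ₗ[F] A.carrier :=
    TensorProduct.rid F A.carrier ∘ₗ
      LinearMap.lTensor A.carrier
        (Finsupp.lapply g ∘ₗ (MonoidAlgebra.coeffLinearEquiv F).toLinearMap)
  have hp : ∀ g h a, p g (a ⊗ₜ MonoidAlgebra.of F G h) = if h = g then a else 0 := by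
    intro g h a
    simp [p, MonoidAlgebra.of_apply, Finsupp.single_apply]
  rw [iSupIndep_def]
  intro g
  rw [Submodule.disjoint_def]
  rintro _ ⟨a, -, rfl⟩ hx
  have hker : ⨆ h, ⨆ (_ : h ≠ g), A.loopDeg h ≤ LinearMap.ker (p g) := by
    refine iSup₂_le fun h hh => ?_
    rintro _ ⟨b, -, rfl⟩
    change p g (b ⊗ₜ MonoidAlgebra.of F G h) = 0
    rw [hp, if_neg hh]
  have h0 : p g (a ⊗ₜ MonoidAlgebra.of F G g) = 0 := hker hx
  rw [hp, if_pos rfl] at h0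
  simp [h0]

/-- The loop algebra `L_π(A)`, as a subalgebra of `A ⊗ F G`, with its `G`-grading. -/
def loop : GradedAlg.{u, v, max u v w} F G where
  carrier := A.loopSpace
  mul := LinearMap.mk₂ F (fun x y => ⟨A.tensorMul x y, A.tensorMul_mem_loopSpace x.2 y.2⟩)
    (fun _ _ _ => Subtype.ext (by simp)) (fun _ _ _ => Subtype.ext (by simp))
    (fun _ _ _ => Subtype.ext (by simp)) (fun _ _ _ => Subtype.ext (by simp))
  deg g := (A.loopDeg g).comap A.loopSpace.subtype
  isInternal := by
    classical
    have hle : ∀ g, A.loopDeg g ≤ A.loopSpace := le_iSup A.loopDeg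
    refine DirectSum.isInternal_submodule_of_iSupIndep_of_iSup_eq_top ?_ ?_
    · rw [iSupIndep_def]
      intro g
      rw [Submodule.disjoint_def]
      intro x hx hx'
      refine Subtype.ext ((Submodule.disjoint_def.1 (A.iSupIndep_loopDeg g)) x.1 hx ?_)
      have hle' : ⨆ h, ⨆ (_ : h ≠ g), (A.loopDeg h).comap A.loopSpace.subtype ≤
          (⨆ h, ⨆ (_ : h ≠ g), A.loopDeg h).comap A.loopSpace.subtype :=
        iSup₂_le fun h hh => Submodule.comap_mono (le_iSup₂_of_le h hh le_rfl)
      exact hle' hx'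
    · refine Submodule.map_injective_of_injective A.loopSpace.subtype_injective ?_
      rw [Submodule.map_iSup, Submodule.map_subtype_top]
      simp only [Submodule.map_comap_subtype, inf_eq_right.2 (hle _)]
      rfl
  mul_mem hx hy := A.tensorMul_mem_loopDeg hx hy

/-- The cocycle twisted loop algebra `L_π^τ(A) = (L_π(A))^τ`. -/
def twistedLoop (τ : Z2sym G Fˣ) : GradedAlg.{u, v, max u v w} F G := A.loop.twist τ

end Loop

section TwistIso

variable (A : GradedAlg.{u, v, w} F G)

theorem twist_one_iso : (A.twist 1).GradedIso A := by
  refine ⟨LinearEquiv.refl F _, ?_, fun _ => Submodule.map_id _⟩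
  have : A.twistMul (1 : Z2sym G Fˣ).1 = A.mul := A.bilin_ext fun g h x hx y hy => by
    rw [A.twistMul_of_mem _ hx hy]
    simp
  exact fun x y => LinearMap.congr_fun₂ this x y

theorem twist_mul_iso (σ τ : Z2sym G Fˣ) :
    (A.twist (σ * τ)).GradedIso ((A.twist σ).twist τ) := by
  refine ⟨LinearEquiv.refl F _, ?_, fun _ => Submodule.map_id _⟩
  have : A.twistMul (σ * τ).1 = (A.twist σ).twistMul τ.1 :=
    A.bilin_ext fun g h x hx y hy => by
      rw [A.twistMul_of_mem _ hx hy]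
      refine Eq.trans ?_ ((A.twist σ).twistMul_of_mem τ.1 hx hy).symm
      change _ = (τ.1 g h : F) • A.twistMul σ.1 x y
      rw [A.twistMul_of_mem _ hx hy, smul_smul, mul_comm]
      simp
  exact fun x y => LinearMap.congr_fun₂ this x y

variable {A} in
theorem GradedIso.twist {B : GradedAlg.{u, v, w} F G} (τ : Z2sym G Fˣ) :
    A.GradedIso B → (A.twist τ).GradedIso (B.twist τ) := by
  rintro ⟨φ, hm, hd⟩
  refine ⟨φ, ?_, hd⟩
  have hφ : ∀ {g x}, x ∈ A.deg g → φ x ∈ B.deg g := fun hx => by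
    rw [← hd]; exact Submodule.mem_map_of_mem hx
  have : (A.twistMul τ.1).compr₂ φ.toLinearMap =
      (B.twistMul τ.1).compl₁₂ φ.toLinearMap φ.toLinearMap :=
    A.bilin_ext fun g h x hx y hy => by
      simp only [LinearMap.compr₂_apply, LinearMap.compl₁₂_apply, LinearEquiv.coe_coe]
      rw [A.twistMul_of_mem _ hx hy, B.twistMul_of_mem _ (hφ hx) (hφ hy), map_smul, hm]
  exact fun x y => LinearMap.congr_fun₂ this x y

end TwistIso

end GradedAlg

/-! ## The two sets of classes -/

section Classes

variable (F : Type u) [Field F] (G : Type v) [CommGroup G]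

/-- Triples `(H, [τ], A)` with `H ≤ G`, `[τ] ∈ H²_sym(G, F^×)` and `A` a central simple and
`G/H`-graded algebra. -/
structure LoopTriple where
  H : Subgroup G
  τ : H2sym G Fˣ
  A : GradedAlg.{u, v, max u v w} F (G ⧸ H)
  centralSimple : A.IsCentralSimple

/-- `G`-graded-central-simple algebras. -/
structure GradedCentralSimpleAlg where
  B : GradedAlg.{u, v, max u v w} F G
  gradedCentralSimple : B.IsGradedCentralSimple

variable {F G}

/-- The relation `(H₁, [τ₁], A₁) ∼ (H₂, [τ₂], A₂)`: `H₁ = H₂ =: H`, `ι^*[τ₁] = ι^*[τ₂]`, and there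
is `μ ∈ Z²_sym(G/H, F^×)` with `[τ₁] = π^*[μ] [τ₂]` and `A₁^μ ≃ A₂` as `G/H`-graded algebras. -/
def LoopTriple.Rel (t₁ t₂ : LoopTriple.{u, v, w} F G) : Prop :=
  ∃ (H : Subgroup G) (τ₁ τ₂ : H2sym G Fˣ) (A₁ A₂ : GradedAlg.{u, v, max u v w} F (G ⧸ H))
    (h₁ : A₁.IsCentralSimple) (h₂ : A₂.IsCentralSimple),
    t₁ = ⟨H, τ₁, A₁, h₁⟩ ∧ t₂ = ⟨H, τ₂, A₂, h₂⟩ ∧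
    H2sym.pullback Fˣ H.subtype τ₁ = H2sym.pullback Fˣ H.subtype τ₂ ∧
    ∃ μ : Z2sym (G ⧸ H) Fˣ,
      τ₁ = H2sym.pullback Fˣ (QuotientGroup.mk' H) (H2sym.mk μ) * τ₂ ∧
      (A₁.twist μ).GradedIso A₂

theorem LoopTriple.rel_equivalence : Equivalence (LoopTriple.Rel.{u, v, w} (F := F) (G := G)) where
  refl t := ⟨t.H, t.τ, t.τ, t.A, t.A, t.centralSimple, t.centralSimple, rfl, rfl, rfl, 1, by
    rw [map_one, map_one, one_mul], t.A.twist_one_iso⟩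
  symm := by
    rintro _ _ ⟨H, τ₁, τ₂, A₁, A₂, h₁, h₂, rfl, rfl, hι, μ, hμ, hA⟩
    refine ⟨H, τ₂, τ₁, A₂, A₁, h₂, h₁, rfl, rfl, hι.symm, μ⁻¹, ?_, ?_⟩
    · rw [hμ, map_inv, map_inv, inv_mul_cancel_left]
    · refine (hA.symm.twist μ⁻¹).trans ((A₁.twist_mul_iso μ μ⁻¹).symm.trans ?_)
      rw [mul_inv_cancel]
      exact A₁.twist_one_iso
  trans := by
    rintro _ _ _ ⟨H, τ₁, τ₂, A₁, A₂, h₁, h₂, rfl, rfl, hι, μ, hμ, hA⟩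
      ⟨H', τ₂', τ₃, A₂', A₃, h₂', h₃, he, rfl, hι', ν, hν, hA'⟩
    cases he
    refine ⟨H, τ₁, τ₃, A₁, A₃, h₁, h₃, rfl, rfl, hι.trans hι', μ * ν, ?_, ?_⟩
    · rw [hμ, hν, map_mul, map_mul, mul_assoc]
    · exact (A₁.twist_mul_iso μ ν).trans ((hA.twist ν).trans hA')

variable (F G)

/-- The equivalence relation `∼` on triples. -/
def LoopTriple.setoid : Setoid (LoopTriple.{u, v, w} F G) := ⟨_, LoopTriple.rel_equivalence⟩

/-- Graded isomorphism of `G`-graded-central-simple algebras. -/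
def GradedCentralSimpleAlg.setoid : Setoid (GradedCentralSimpleAlg.{u, v, w} F G) :=
  ⟨fun B₁ B₂ => B₁.B.GradedIso B₂.B, fun B => .refl B.B, .symm, .trans⟩

/-- The set of equivalence classes of triples `(H, [τ], A)`. -/
def TripleClasses : Type _ := Quotient (LoopTriple.setoid.{u, v, w} F G)

/-- The set of isomorphism classes of `G`-graded-central-simple algebras. -/
def AlgClasses : Type _ := Quotient (GradedCentralSimpleAlg.setoid.{u, v, w} F G)

variable {F G}

/-- The class `[(H, [τ], A)]`. -/
def LoopTriple.toClass (t : LoopTriple.{u, v, w} F G) : TripleClasses.{u, v, w} F G :=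
  Quotient.mk _ t

/-- The class `[B]`. -/
def GradedCentralSimpleAlg.toClass (B : GradedCentralSimpleAlg.{u, v, w} F G) :
    AlgClasses.{u, v, w} F G :=
  Quotient.mk _ B

end Classes

end

/-!
The projection `L_π(A) → A`, `a ⊗ g ↦ a`, maps the component of degree `g` isomorphically onto the
component of degree `π(g)`, and on `L_π^τ(A)` it is multiplicative up to the factor `τ(g, h)`. Such
a *twisted cover* determines its source, and it is a loop algebra of its base up to a graded
isomorphism; twists and graded isomorphisms are twisted covers as well.

If the base is central simple, then the homogeneous centroid elements of the cover are the lifts of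
the scalars. They live in the degrees in `H`, one line in each degree, and they multiply by `τ`; so
the cover determines `H` and the restriction of `τ` to `H`, and a function `γ` on `H` that
trivialises a quotient of two such cocycles extends to `G`, so that this quotient becomes inflated
from `G ⧸ H`.

Conversely, the centroid of a graded-central-simple algebra `B` is a twisted group algebra of a
subgroup `H` of `G`. As `F^×` embeds in a divisible group, its cocycle extends to `G`; after the
inverse twist, the homogeneous centroid elements can be normalised to a copy of `H`, and identifying
its orbits gives the base. The base is simple because an element of minimal support in a nonzero
ideal yields centroid elements of `B`.
-/

universe x y z

noncomputable section

/-! ## Symmetric cocycles -/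

section Divisible

theorem exists_injective_monoidHom_divisible (M : Type x) [CommGroup M] :
    ∃ (D : Type x) (_ : CommGroup D) (_ : DivisibleBy (Additive D) ℤ) (j : M →* D),
      Function.Injective j := by
  let j : Additive M →+ (CharacterModule (Additive M) → AddCircle (1 : ℚ)) :=
    ⟨⟨fun a χ => χ a, funext fun χ => map_zero χ⟩, fun a b => funext fun χ => map_add χ a b⟩
  refine ⟨Multiplicative (CharacterModule (Additive M) → AddCircle (1 : ℚ)), inferInstance,
    inferInstanceAs (DivisibleBy (CharacterModule (Additive M) → AddCircle (1 : ℚ)) ℤ),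
    AddMonoidHom.toMultiplicativeRight j, (injective_iff_map_eq_zero j).2 fun a ha => ?_⟩
  by_contra hne
  obtain ⟨χ, hχ⟩ := CharacterModule.exists_character_apply_ne_zero_of_ne_zero hne
  exact hχ (congrFun ha χ)

theorem exists_monoidHom_extension {A : Type x} {B : Type y} {D : Type*}
    [CommGroup A] [CommGroup B] [CommGroup D] [DivisibleBy (Additive D) ℤ] {i : A →* B}
    (hi : Function.Injective i) (f : A →* D) : ∃ f' : B →* D, ∀ a, f' (i a) = f a := by
  obtain ⟨φ, hφ⟩ := (Module.Baer.of_divisible (Additive D)).extension_property_addMonoidHom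
    (MonoidHom.toAdditive i) hi (MonoidHom.toAdditive f)
  exact ⟨MonoidHom.toAdditive.symm φ, DFunLike.congr_fun hφ⟩

end Divisible

namespace Z2sym

variable {A M : Type*} [CommGroup A] [CommGroup M]

theorem cocycle (σ : Z2sym A M) (a b c : A) :
    σ.1 a b * σ.1 (a * b) c = σ.1 a (b * c) * σ.1 b c :=
  σ.2.1 a b c

theorem symm (σ : Z2sym A M) (a b : A) : σ.1 a b = σ.1 b a := σ.2.2 a b

theorem cocycle_left_comm (σ : Z2sym A M) (a b c : A) :
    σ.1 a (b * c) * σ.1 b c = σ.1 b (a * c) * σ.1 a c := by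
  rw [← cocycle, ← cocycle, symm, mul_comm a]

theorem apply_one_left (σ : Z2sym A M) (a : A) : σ.1 1 a = σ.1 1 1 := by
  simpa using (cocycle σ 1 1 a).symm

theorem comap_id (σ : Z2sym A M) : Z2sym.comap M (MonoidHom.id A) σ = σ := rfl

/-- The coboundary `dγ`, as a symmetric cocycle. -/
def coboundary : (A → M) →* Z2sym A M :=
  (coboundaryHom A M).codRestrict (Z2sym A M) fun γ => B2_le_Z2sym A M ⟨γ, rfl⟩

theorem coboundary_apply (γ : A → M) (a b : A) :
    (coboundary γ).1 a b = γ a * γ b * (γ (a * b))⁻¹ :=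
  rfl

/-- The abelian extension of `A` by `M` defined by a symmetric cocycle: pairs with the product
`(a, m) (b, n) = (a b, m n σ(a, b))`. -/
@[ext]
structure Extension (σ : Z2sym A M) where
  base : A
  fiber : M

namespace Extension

variable {σ : Z2sym A M}

instance : Mul (Extension σ) :=
  ⟨fun p q => ⟨p.base * q.base, p.fiber * q.fiber * σ.1 p.base q.base⟩⟩

instance : One (Extension σ) := ⟨⟨1, (σ.1 1 1)⁻¹⟩⟩

instance : Inv (Extension σ) :=
  ⟨fun p => ⟨p.base⁻¹, (σ.1 1 1)⁻¹ * (σ.1 p.base⁻¹ p.base)⁻¹ * p.fiber⁻¹⟩⟩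

theorem mk_mul_mk (a b : A) (m n : M) :
    (⟨a, m⟩ * ⟨b, n⟩ : Extension σ) = ⟨a * b, m * n * σ.1 a b⟩ :=
  rfl

theorem inv_mk (a : A) (m : M) :
    (⟨a, m⟩⁻¹ : Extension σ) = ⟨a⁻¹, (σ.1 1 1)⁻¹ * (σ.1 a⁻¹ a)⁻¹ * m⁻¹⟩ :=
  rfl

theorem one_def : (1 : Extension σ) = ⟨1, (σ.1 1 1)⁻¹⟩ := rfl

instance : CommGroup (Extension σ) where
  toGroup := Group.ofLeftAxioms
    (by
      rintro ⟨a, l⟩ ⟨b, m⟩ ⟨c, n⟩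
      simp only [mk_mul_mk, mk.injEq, mul_assoc a, true_and]
      calc l * m * σ.1 a b * n * σ.1 (a * b) c
          = l * m * n * (σ.1 a b * σ.1 (a * b) c) := by rw [mul_right_comm _ _ n, mul_assoc]
        _ = l * m * n * (σ.1 b c * σ.1 a (b * c)) := by rw [cocycle σ, mul_comm (σ.1 b c)]
        _ = l * (m * n * σ.1 b c) * σ.1 a (b * c) := by simp only [mul_assoc])
    (by
      rintro ⟨a, m⟩
      simp [one_def, mk_mul_mk, apply_one_left σ a, mul_right_comm _ m])
    (by
      rintro ⟨a, m⟩
      simp [one_def, inv_mk, mk_mul_mk])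
  mul_comm := by
    rintro ⟨a, m⟩ ⟨b, n⟩
    simp only [mk_mul_mk, mul_comm a, mul_comm m, symm σ a]

/-- The embedding of `M` as the kernel of `Extension σ → A`. -/
def incl (σ : Z2sym A M) : M →* Extension σ where
  toFun m := ⟨1, m * (σ.1 1 1)⁻¹⟩
  map_one' := by rw [one_mul, one_def]
  map_mul' m n := by
    rw [mk_mul_mk, mul_one, mul_mul_mul_comm, ← mul_assoc (m * n), inv_mul_cancel_right]

theorem incl_injective (σ : Z2sym A M) : Function.Injective (incl σ) := fun _ _ h =>
  mul_right_cancel (congrArg fiber h)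

theorem mk_one_mul_mk_one (a b : A) :
    (⟨a, 1⟩ * ⟨b, 1⟩ : Extension σ) = incl σ (σ.1 a b) * ⟨a * b, 1⟩ := by
  change _ = (⟨1, σ.1 a b * (σ.1 1 1)⁻¹⟩ * ⟨a * b, 1⟩ : Extension σ)
  simp [mk_mul_mk, apply_one_left σ (a * b)]

end Extension

theorem exists_map_eq_coboundary {D : Type*} [CommGroup D] [DivisibleBy (Additive D) ℤ]
    (σ : Z2sym A M) (j : M →* D) : ∃ e : A → D, ∀ a b, j (σ.1 a b) = (coboundary e).1 a b := by
  obtain ⟨ψ, hψ⟩ := exists_monoidHom_extension (Extension.incl_injective σ) j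
  refine ⟨fun a => ψ ⟨a, 1⟩, fun a b => ?_⟩
  rw [coboundary_apply, ← map_mul ψ, Extension.mk_one_mul_mk_one, map_mul, hψ,
    mul_inv_cancel_right]

theorem exists_map_eq_of_coboundary_mem_range {D : Type*} [CommGroup D] {j : M →* D}
    (hj : Function.Injective j) {t : A → D} (ht : ∀ a b, (coboundary t).1 a b ∈ j.range) :
    ∃ τ : Z2sym A M, ∀ a b, j (τ.1 a b) = (coboundary t).1 a b := by
  choose τ hτ using ht
  refine ⟨⟨τ, fun a b c => hj ?_, fun a b => hj ?_⟩, hτ⟩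
  · simp only [map_mul, hτ, cocycle (coboundary t)]
  · rw [hτ, hτ, symm (coboundary t)]

end Z2sym

section Subgroup

variable {G M : Type*} [CommGroup G] [CommGroup M]

/-- The obstruction to extending a cocycle from `H` to `G` lies in `Ext²(G/H, M) = 0`. Concretely,
embed `M` in a divisible group `D` and write the cocycle as `de` with `e : H → D`. The
homomorphism `H → D/M` induced by `e` extends to `G`; a lift `t : G → D` of this extension with
`t = e` on `H` has `dt` in `M`. -/
theorem Z2sym.comap_subtype_surjective (H : Subgroup G) :
    Function.Surjective (Z2sym.comap M H.subtype) := by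
  classical
  intro σ
  obtain ⟨D, _, _, j, hj⟩ := exists_injective_monoidHom_divisible M
  obtain ⟨e, he⟩ := Z2sym.exists_map_eq_coboundary σ j
  let q := QuotientGroup.mk' j.range
  have hq (d : D) : q d = 1 ↔ d ∈ j.range := QuotientGroup.eq_one_iff d
  have hqs : Function.Surjective q := QuotientGroup.mk'_surjective _
  let θ₀ : H →* D ⧸ j.range := MonoidHom.mk' (fun h => q (e h)) fun h k => by
    have hσ : q (j (σ.1 h k)) = 1 := (hq _).2 ⟨_, rfl⟩
    rw [he, Z2sym.coboundary_apply, map_mul, map_inv, mul_inv_eq_one, map_mul] at hσ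
    exact hσ.symm
  let _ : DivisibleBy (Additive (D ⧸ j.range)) ℤ :=
    Function.Surjective.divisibleBy (MonoidHom.toAdditive q) hqs fun a n => map_zsmul _ n a
  obtain ⟨θ, hθ⟩ := exists_monoidHom_extension H.subtype_injective θ₀
  have hlift (g : G) : ∃ d, q d = θ g ∧ ∀ hg : g ∈ H, d = e ⟨g, hg⟩ := by
    by_cases hg : g ∈ H
    · exact ⟨e ⟨g, hg⟩, (hθ ⟨g, hg⟩).symm, fun _ => rfl⟩
    · exact (hqs (θ g)).imp fun d hd => ⟨hd, fun h => absurd h hg⟩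
  choose t ht hte using hlift
  obtain ⟨τ, hτ⟩ := Z2sym.exists_map_eq_of_coboundary_mem_range hj (t := t) fun a b => by
    rw [← hq, Z2sym.coboundary_apply, map_mul, map_mul, map_inv, ht, ht, ht, map_mul,
      mul_inv_cancel]
  refine ⟨τ, Subtype.ext (funext₂ fun h k => hj ?_)⟩
  change j (τ.1 h k) = _
  rw [hτ, he, Z2sym.coboundary_apply, Z2sym.coboundary_apply, hte h h.2, hte k k.2,
    hte (h * k) (h * k).2]
  rfl

theorem exists_coset_representatives (H : Subgroup G) :
    ∃ (s : G → G) (r : G → H), (∀ g, s g * r g = g) ∧ ∀ (g : G) (h : H), s (g * h) = s g := by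
  have hout (g : G) : ((g : G ⧸ H).out)⁻¹ * g ∈ H := QuotientGroup.eq.1 (QuotientGroup.out_eq' _)
  refine ⟨fun g => (g : G ⧸ H).out, fun g => ⟨_, hout g⟩, fun g => mul_inv_cancel_left _ _,
    fun g h => ?_⟩
  simp only [QuotientGroup.mk_mul_of_mem g h.2]

/-- On the coset `s H` the function `γ` is determined by `γ s` through `τ(s, h) = dγ(s, h)`; the
cocycle identity then gives `τ(s k, h) = dγ(s k, h)`. -/
theorem Z2sym.exists_extend_coboundary {H : Subgroup G} (τ : Z2sym G M) (m : H → M)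
    (hm : Z2sym.comap M H.subtype τ = Z2sym.coboundary m) :
    ∃ γ : G → M, (∀ h : H, γ h = m h) ∧
      ∀ (g : G) (h : H), τ.1 g h = (Z2sym.coboundary γ).1 g h := by
  obtain ⟨s, r, hsr, hs⟩ := exists_coset_representatives H
  have hm' (h k : H) : τ.1 h k * m (h * k) = m h * m k := by
    have := congrFun₂ (congrArg Subtype.val hm) h k
    rw [Z2sym.coboundary_apply, eq_mul_inv_iff_mul_eq] at this
    exact this
  have hr (g : G) (h : H) : r (g * h) = r g * h := by
    refine Subtype.ext (mul_left_cancel (a := s g) ?_)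
    rw [← hs g h, hsr, hs, Subgroup.coe_mul, ← mul_assoc, hsr]
  have hs₁ : s 1 = (r 1)⁻¹ := eq_inv_of_mul_eq_one_left (hsr 1)
  let γ (g : G) : M := m (r 1)⁻¹ * m (r g) * (τ.1 (s g) (r g))⁻¹
  have hγ (h : H) : γ h = m h := by
    have hs_h : s h = (r 1)⁻¹ := by rw [← hs₁, ← hs 1 h, one_mul]
    have hr_h : r h = r 1 * h := by rw [← hr, one_mul]
    simpa [γ, hs_h, hr_h, mul_inv_eq_iff_eq_mul, mul_comm (m h)] using
      (hm' (r 1)⁻¹ (r 1 * h)).symm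
  refine ⟨γ, hγ, fun g h => ?_⟩
  have hτ : (τ.1 (s g) (r g))⁻¹ * (τ.1 (s g) (r g * h) * τ.1 (r g) h) = τ.1 g h := by
    rw [inv_mul_eq_iff_eq_mul, ← Z2sym.cocycle τ, hsr]
  rw [Z2sym.coboundary_apply, eq_mul_inv_iff_mul_eq, hγ]
  calc τ.1 g h * γ (g * h)
      = τ.1 g h * (m (r 1)⁻¹ * m (r g * h) * (τ.1 (s g) (r g * h))⁻¹) := by
        simp only [γ, hs, hr, Subgroup.coe_mul]
    _ = m (r 1)⁻¹ * (τ.1 (r g) h * m (r g * h)) * (τ.1 (s g) (r g))⁻¹ := by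
        grind [mul_inv_cancel (τ.1 (s g) (r g * h))]
    _ = γ g * m h := by rw [hm', ← mul_assoc, mul_right_comm]

theorem Z2sym.exists_comap_eq {K : Type*} [CommGroup K] {φ : G →* K}
    (hφ : Function.Surjective φ) (ρ : Z2sym G M) (hρ : ∀ g, ∀ h ∈ φ.ker, ρ.1 g h = 1) :
    ∃ μ : Z2sym K M, Z2sym.comap M φ μ = ρ := by
  have hr {a b : G} (hab : φ a = φ b) (c : G) : ρ.1 c b = ρ.1 c a := by
    have hker : a⁻¹ * b ∈ φ.ker := by
      rw [MonoidHom.mem_ker, map_mul, map_inv, hab, inv_mul_cancel]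
    simpa only [hρ _ _ hker, mul_one, mul_inv_cancel_left] using
      (Z2sym.cocycle ρ c a (a⁻¹ * b)).symm
  have hcongr {g g' k k' : G} (hg : φ g = φ g') (hk : φ k = φ k') : ρ.1 g k = ρ.1 g' k' := by
    rw [← hr hk, Z2sym.symm ρ, ← hr hg, Z2sym.symm ρ]
  choose r hφr using hφ
  refine ⟨⟨fun a b => ρ.1 (r a) (r b), fun a b c => ?_, fun a b => Z2sym.symm ρ _ _⟩,
    Subtype.ext (funext₂ fun g k => hcongr (hφr _) (hφr _))⟩
  have hmul (a b : K) : φ (r (a * b)) = φ (r a * r b) := by rw [map_mul, hφr, hφr, hφr]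
  beta_reduce
  rw [hcongr (hmul a b) rfl, hcongr rfl (hmul b c), Z2sym.cocycle ρ]

end Subgroup

namespace GradedAlg

variable {F : Type u} [Field F] {G : Type v} [CommGroup G]

/-! ## Homogeneous components -/

section Components

variable (A : GradedAlg.{u, v, w} F G)

open scoped Classical

instance : DirectSum.Decomposition A.deg := A.isInternal.chooseDecomposition

/-- The projection of `A` onto its component of degree `g`. -/
def proj (g : G) : Module.End F A.carrier :=
  (A.deg g).subtype ∘ₗ DirectSum.component F G (fun g => A.deg g) g ∘ₗ
    (DirectSum.decomposeLinearEquiv A.deg).toLinearMap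

/-- The set of degrees of the nonzero homogeneous components of `x`. -/
def support (x : A.carrier) : Finset G := DFinsupp.support (DirectSum.decompose A.deg x)

variable {A}

theorem proj_mem (g : G) (x : A.carrier) : A.proj g x ∈ A.deg g :=
  (DirectSum.decompose A.deg x g).2

theorem proj_of_mem {g : G} {x : A.carrier} (hx : x ∈ A.deg g) : A.proj g x = x :=
  DirectSum.decompose_of_mem_same A.deg hx

theorem proj_of_mem_ne {g k : G} {x : A.carrier} (hx : x ∈ A.deg k) (h : k ≠ g) :
    A.proj g x = 0 :=
  DirectSum.decompose_of_mem_ne A.deg hx h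

theorem mem_support {g : G} {x : A.carrier} : g ∈ A.support x ↔ A.proj g x ≠ 0 :=
  DFinsupp.mem_support_iff.trans (not_congr Submodule.coe_eq_zero.symm)

theorem eq_zero_of_proj {x : A.carrier} (h : ∀ g, A.proj g x = 0) : x = 0 :=
  (DirectSum.decomposeLinearEquiv A.deg).map_eq_zero_iff.1
    (DFinsupp.ext fun g => Subtype.ext (h g))

theorem sum_support_proj (x : A.carrier) : ∑ g ∈ A.support x, A.proj g x = x :=
  DirectSum.sum_support_decompose A.deg x

theorem mem_deg_of_proj_eq_zero {g : G} {x : A.carrier} (h : ∀ k, k ≠ g → A.proj k x = 0) :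
    x ∈ A.deg g := by
  rw [← sum_support_proj x]
  refine Submodule.sum_mem _ fun k hk => ?_
  obtain rfl := of_not_not (mt (h k) (mem_support.1 hk))
  exact proj_mem k x

theorem induction_on_homogeneous {p : A.carrier → Prop} (zero : p 0)
    (add : ∀ x y, p x → p y → p (x + y)) (homogeneous : ∀ g, ∀ x ∈ A.deg g, p x)
    (x : A.carrier) : p x :=
  DirectSum.Decomposition.inductionOn A.deg zero (fun x => homogeneous _ x x.2) add x

section LinearMap

variable {V : Type*} [AddCommGroup V] [Module F V]

theorem linearMap_ext {f f' : A.carrier →ₗ[F] V} (h : ∀ g, ∀ x ∈ A.deg g, f x = f' x) : f = f' :=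
  DirectSum.decompose_lhom_ext A.deg fun g => LinearMap.ext fun x => h g x x.2

/-- The linear map with prescribed restrictions to the homogeneous components. -/
def lift (f : ∀ g, A.deg g →ₗ[F] V) : A.carrier →ₗ[F] V :=
  DirectSum.toModule F G V f ∘ₗ (DirectSum.decomposeLinearEquiv A.deg).toLinearMap

theorem lift_of_mem (f : ∀ g, A.deg g →ₗ[F] V) {g : G} {x : A.carrier} (hx : x ∈ A.deg g) :
    lift f x = f g ⟨x, hx⟩ := by
  change DirectSum.toModule F G V f (DirectSum.decompose A.deg x) = _
  rw [DirectSum.decompose_of_mem A.deg hx]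
  exact DirectSum.toModule_lof F g _

end LinearMap

end Components

section HasDegree

variable {A : GradedAlg.{u, v, w} F G} {B : GradedAlg.{u, v, x} F G}

theorem eq_zero_of_mem_of_mem {g k : G} {x : A.carrier} (hg : x ∈ A.deg g) (hk : x ∈ A.deg k)
    (h : g ≠ k) : x = 0 := by
  rw [← proj_of_mem hg, proj_of_mem_ne hk h.symm]

theorem eq_top_of_deg_le {I : Submodule F A.carrier} (h : ∀ g, A.deg g ≤ I) : I = ⊤ :=
  eq_top_iff.2 fun x _ =>
    induction_on_homogeneous (zero_mem I) (fun _ _ => add_mem) (fun g _ hx => h g hx) x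

/-- A linear map between graded algebras that is homogeneous of degree `k`. -/
def HasDegree (f : A.carrier →ₗ[F] B.carrier) (k : G) : Prop :=
  ∀ ⦃g : G⦄, ∀ x ∈ A.deg g, f x ∈ B.deg (k * g)

theorem HasDegree.proj_apply {f : A.carrier →ₗ[F] B.carrier} {k : G} (hf : HasDegree f k) (g : G)
    (x : A.carrier) : B.proj (k * g) (f x) = f (A.proj g x) := by
  suffices B.proj (k * g) ∘ₗ f = f ∘ₗ A.proj g from LinearMap.congr_fun this x
  refine linearMap_ext fun l x hx => ?_
  change B.proj (k * g) (f x) = f (A.proj g x)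
  by_cases h : l = g
  · subst h
    rw [proj_of_mem (hf _ hx), proj_of_mem hx]
  · rw [proj_of_mem_ne (hf _ hx) (mt mul_left_cancel h), proj_of_mem_ne hx h, map_zero]

theorem bijective_of_components {f : A.carrier →ₗ[F] B.carrier}
    (hf : ∀ g, Set.BijOn f (A.deg g) (B.deg g)) : Function.Bijective f := by
  have hdeg : HasDegree f 1 := fun g x hx => (one_mul g).symm ▸ (hf g).mapsTo hx
  refine ⟨(injective_iff_map_eq_zero f).2 fun x hx => eq_zero_of_proj fun g => ?_, ?_⟩
  · refine (hf g).injOn (proj_mem g x) (zero_mem _) ?_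
    rw [← hdeg.proj_apply, hx, map_zero, map_zero]
  · exact LinearMap.range_eq_top.1 <| eq_top_of_deg_le fun g y hy =>
      ((hf g).surjOn hy).imp fun _ hx => hx.2

end HasDegree

/-! ## Multiplication operators and graded ideals -/

section MulOps

variable (A : GradedAlg.{u, v, w} F G)

/-- The left and right multiplications by homogeneous elements of degree `k`. Working with these
operators treats the two sides of the (noncommutative) multiplication at once. -/
def mulOps (k : G) : Set (Module.End F A.carrier) :=
  {T | ∃ b ∈ A.deg k, T = A.mul b ∨ T = A.mul.flip b}

variable {A}

theorem mul_mem_mulOps {k : G} {b : A.carrier} (hb : b ∈ A.deg k) : A.mul b ∈ A.mulOps k :=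
  ⟨b, hb, .inl rfl⟩

theorem flip_mem_mulOps {k : G} {b : A.carrier} (hb : b ∈ A.deg k) : A.mul.flip b ∈ A.mulOps k :=
  ⟨b, hb, .inr rfl⟩

theorem hasDegree_of_mem_mulOps {k : G} {T : Module.End F A.carrier} (hT : T ∈ A.mulOps k) :
    HasDegree T k := by
  rintro g x hx
  obtain ⟨b, hb, rfl | rfl⟩ := hT
  · exact A.mul_mem hb hx
  · exact mul_comm g k ▸ A.mul_mem hx hb

theorem isIdeal_iff {I : Submodule F A.carrier} :
    A.IsIdeal I ↔ ∀ k, ∀ T ∈ A.mulOps k, ∀ x ∈ I, T x ∈ I := by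
  constructor
  · rintro hI k _ ⟨b, -, rfl | rfl⟩ x hx
    exacts [(hI b x hx).1, (hI b x hx).2]
  · intro hI a x hx
    induction a using induction_on_homogeneous with
    | zero => simp
    | add a b ha hb =>
      simp only [map_add, LinearMap.add_apply]
      exact ⟨add_mem ha.1 hb.1, add_mem ha.2 hb.2⟩
    | homogeneous k a ha =>
      exact ⟨hI k _ (mul_mem_mulOps ha) x hx, hI k _ (flip_mem_mulOps ha) x hx⟩

theorem mem_centroid_iff {c : Module.End F A.carrier} :
    c ∈ A.centroid ↔ ∀ k, ∀ T ∈ A.mulOps k, ∀ x, c (T x) = T (c x) := by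
  constructor
  · rintro hc k _ ⟨b, -, rfl | rfl⟩ x
    exacts [(hc b x).2, (hc x b).1]
  · intro hc x y
    constructor
    · refine LinearMap.congr_fun (linearMap_ext (f := c ∘ₗ A.mul x) (f' := A.mul (c x)) ?_) y
      exact fun k b hb => hc k _ (flip_mem_mulOps hb) x
    · refine LinearMap.congr_fun
        (linearMap_ext (f := c ∘ₗ A.mul.flip y) (f' := A.mul.flip (c y)) ?_) x
      exact fun k b hb => hc k _ (mul_mem_mulOps hb) y

theorem mem_centroidDeg {c : Module.End F A.carrier} {g : G} (hdeg : HasDegree c g)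
    (hc : ∀ k, ∀ T ∈ A.mulOps k, ∀ l, ∀ x ∈ A.deg l, c (T x) = T (c x)) : c ∈ A.centroidDeg g :=
  ⟨mem_centroid_iff.2 fun k T hT => LinearMap.congr_fun
    (linearMap_ext (f := c ∘ₗ T) (f' := T ∘ₗ c) (hc k T hT)), hdeg⟩

theorem map_mulOps_of_mem_centroidDeg {c : Module.End F A.carrier} {g k : G}
    (hc : c ∈ A.centroidDeg g) {T : Module.End F A.carrier} (hT : T ∈ A.mulOps k)
    (x : A.carrier) : c (T x) = T (c x) :=
  mem_centroid_iff.1 hc.1 k T hT x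

theorem square_eq_top_iff : A.square = ⊤ ↔
    ∀ I : Submodule F A.carrier, (∀ k, ∀ T ∈ A.mulOps k, ∀ g, ∀ x ∈ A.deg g, T x ∈ I) → I = ⊤ := by
  constructor
  · intro h I hI
    rw [eq_top_iff, ← h, square, Submodule.map₂_le]
    rintro x - y -
    induction y using induction_on_homogeneous with
    | zero => simp
    | add y z hy hz => simpa only [map_add] using add_mem hy hz
    | homogeneous k y hy =>
      induction x using induction_on_homogeneous with
      | zero => simp
      | add x z hx hz => simpa only [map_add, LinearMap.add_apply] using add_mem hx hz
      | homogeneous g x hx => exact hI g _ (mul_mem_mulOps hx) k y hy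
  · refine fun h => h _ ?_
    rintro k _ ⟨b, -, rfl | rfl⟩ g x -
    exacts [Submodule.apply_mem_map₂ _ trivial trivial, Submodule.apply_mem_map₂ _ trivial trivial]

end MulOps

section Ideals

variable (A : GradedAlg.{u, v, w} F G)

/-- The families of homogeneous components of graded ideals. -/
def IsIdealFamily (S : G → Submodule F A.carrier) : Prop :=
  (∀ g, S g ≤ A.deg g) ∧ ∀ k, ∀ T ∈ A.mulOps k, ∀ g, ∀ x ∈ S g, T x ∈ S (k * g)

variable {A} {S : G → Submodule F A.carrier}

theorem IsIdealFamily.isGradedIdeal (hS : A.IsIdealFamily S) : A.IsGradedIdeal (⨆ g, S g) := by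
  refine ⟨isIdeal_iff.2 fun k T hT x hx => ?_,
    le_antisymm (iSup_mono fun g => le_inf (le_iSup S g) (hS.1 g)) (iSup_le fun g => inf_le_left)⟩
  have hle : ⨆ g, S g ≤ (⨆ g, S g).comap T := iSup_le fun g x hx =>
    Submodule.mem_iSup_of_mem (k * g) (hS.2 k T hT g x hx)
  exact hle hx

theorem mem_of_mem_iSup (hS : ∀ g, S g ≤ A.deg g) {g : G} {x : A.carrier}
    (hx : x ∈ ⨆ g, S g) (hg : x ∈ A.deg g) : x ∈ S g := by
  have hle : ⨆ g, S g ≤ (S g).comap (A.proj g) := iSup_le fun k y hy => by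
    rw [Submodule.mem_comap]
    by_cases h : k = g
    · subst h
      rwa [proj_of_mem (hS _ hy)]
    · rw [proj_of_mem_ne (hS _ hy) h]
      exact zero_mem _
  simpa only [Submodule.mem_comap, proj_of_mem hg] using hle hx

theorem IsGradedSimple.eq_bot_or_eq_deg (hA : A.IsGradedSimple) (hS : A.IsIdealFamily S) :
    (∀ g, S g = ⊥) ∨ ∀ g, S g = A.deg g := by
  rcases hA.2.2 _ hS.isGradedIdeal with h | h
  · exact .inl fun g => le_bot_iff.1 (h ▸ le_iSup S g)
  · exact .inr fun g => le_antisymm (hS.1 g) fun x hx => mem_of_mem_iSup hS.1 (h ▸ trivial) hx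

theorem isIdealFamily_inf {I : Submodule F A.carrier} (hI : A.IsIdeal I) :
    A.IsIdealFamily fun g => I ⊓ A.deg g :=
  ⟨fun _ => inf_le_right, fun k T hT _ x hx =>
    ⟨isIdeal_iff.1 hI k T hT x hx.1, hasDegree_of_mem_mulOps hT x hx.2⟩⟩

theorem isGradedSimple_of_isIdealFamily (h₀ : Nontrivial A.carrier) (hsq : A.square = ⊤)
    (h : ∀ S, A.IsIdealFamily S → (∀ g, S g = ⊥) ∨ ∀ g, A.deg g ≤ S g) : A.IsGradedSimple := by
  refine ⟨h₀, hsq, fun I hI => ?_⟩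
  rcases h _ (isIdealFamily_inf hI.1) with h | h
  · exact .inl (hI.2.trans (iSup_eq_bot.2 h))
  · exact .inr (eq_top_of_deg_le fun g => (h g).trans inf_le_left)

theorem IsGradedSimple.eq_zero_of_mulOps (hA : A.IsGradedSimple) {g : G} {x : A.carrier}
    (hx : x ∈ A.deg g) (h : ∀ k, ∀ T ∈ A.mulOps k, T x = 0) : x = 0 := by
  let annihilator : Submodule F A.carrier := ⨅ k, ⨅ T ∈ A.mulOps k, LinearMap.ker T
  have hmem {y : A.carrier} : y ∈ annihilator ↔ ∀ k, ∀ T ∈ A.mulOps k, T y = 0 := by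
    simp [annihilator]
  have hS : A.IsIdealFamily fun g => annihilator ⊓ A.deg g :=
    ⟨fun g => inf_le_right, fun k T hT g y hy => by simp [hmem.1 hy.1 k T hT]⟩
  rcases hA.eq_bot_or_eq_deg hS with hbot | htop
  · exact (Submodule.eq_bot_iff _).1 (hbot g) x ⟨hmem.2 h, hx⟩
  · have hzero : (⊥ : Submodule F A.carrier) = ⊤ := square_eq_top_iff.1 hA.2.1 _
      fun k T hT g y hy => hmem.1 (inf_eq_right.1 (htop g) hy) k T hT
    have := hA.1
    exact absurd hzero bot_ne_top

end Ideals

/-! ## The graded centroid -/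

section Centroid

variable {A : GradedAlg.{u, v, w} F G} {g k : G} {c d : Module.End F A.carrier}

theorem one_mem_centroidDeg : (1 : Module.End F A.carrier) ∈ A.centroidDeg 1 :=
  ⟨one_mem _, fun k _ hx => (one_mul k).symm ▸ hx⟩

theorem mul_mem_centroidDeg (hc : c ∈ A.centroidDeg g) (hd : d ∈ A.centroidDeg k) :
    c * d ∈ A.centroidDeg (g * k) :=
  ⟨A.centroid.mul_mem hc.1 hd.1, fun l _ hx => (mul_assoc g k l).symm ▸ hc.2 _ _ (hd.2 _ _ hx)⟩

theorem mul_comm_of_mem_centroid (hA : A.square = ⊤) (hc : c ∈ A.centroid) (hd : d ∈ A.centroid) :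
    c * d = d * c := by
  refine LinearMap.ext fun x => ?_
  have hx : x ∈ A.square := hA ▸ trivial
  have hle : A.square ≤ LinearMap.eqLocus (c * d) (d * c) := Submodule.map₂_le.2 fun x _ y _ => by
    rw [LinearMap.mem_eqLocus, Module.End.mul_apply, Module.End.mul_apply, (hd x y).2, (hc x _).1,
      (hc x y).1, (hd _ y).2]
  exact hle hx

theorem exists_homogeneous_apply_ne_zero (h₀ : c ≠ 0) : ∃ k, ∃ x ∈ A.deg k, c x ≠ 0 := by
  by_contra! h
  exact h₀ (linearMap_ext fun k x hx => h k x hx)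

namespace IsGradedSimple

variable (hA : A.IsGradedSimple)

include hA in
theorem injective_of_mem_centroidDeg (hc : c ∈ A.centroidDeg g) (h₀ : c ≠ 0) :
    Function.Injective c := by
  obtain ⟨k₀, x₀, hx₀, hcx₀⟩ := exists_homogeneous_apply_ne_zero h₀
  have hker : A.IsIdeal (LinearMap.ker c) := isIdeal_iff.2 fun k T hT x hx => by
    rw [LinearMap.mem_ker] at hx ⊢
    rw [map_mulOps_of_mem_centroidDeg hc hT, hx, map_zero]
  rcases hA.eq_bot_or_eq_deg (isIdealFamily_inf hker) with h | h
  · refine (injective_iff_map_eq_zero c).2 fun x hx => eq_zero_of_proj fun k => ?_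
    refine (Submodule.eq_bot_iff _).1 (h k) _ ⟨?_, proj_mem k x⟩
    change c (A.proj k x) = 0
    rw [← HasDegree.proj_apply hc.2, hx, map_zero]
  · exact absurd (inf_eq_right.1 (h k₀) hx₀) hcx₀

include hA in
theorem surjective_of_mem_centroidDeg (hc : c ∈ A.centroidDeg g) (h₀ : c ≠ 0) :
    Function.Surjective c := by
  obtain ⟨k₀, x₀, hx₀, hcx₀⟩ := exists_homogeneous_apply_ne_zero h₀
  have himage : A.IsIdealFamily fun k => (A.deg (g⁻¹ * k)).map c := by
    refine ⟨?_, ?_⟩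
    · rintro k _ ⟨x, hx, rfl⟩
      simpa using hc.2 _ x hx
    · rintro k T hT l _ ⟨x, hx, rfl⟩
      refine ⟨T x, ?_, map_mulOps_of_mem_centroidDeg hc hT x⟩
      rw [mul_left_comm]
      exact hasDegree_of_mem_mulOps hT x hx
  rcases hA.eq_bot_or_eq_deg himage with h | h
  · exact absurd ((Submodule.eq_bot_iff _).1 (h (g * k₀)) (c x₀) ⟨x₀, by simpa using hx₀, rfl⟩) hcx₀
  · exact LinearMap.range_eq_top.1
      (eq_top_of_deg_le fun k => (h k).symm.le.trans LinearMap.map_le_range)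

include hA in
theorem exists_inverse (hc : c ∈ A.centroidDeg g) (h₀ : c ≠ 0) :
    ∃ d ∈ A.centroidDeg g⁻¹, c * d = 1 ∧ d * c = 1 := by
  have hinj := hA.injective_of_mem_centroidDeg hc h₀
  let e := LinearEquiv.ofBijective c ⟨hinj, hA.surjective_of_mem_centroidDeg hc h₀⟩
  have he (x : A.carrier) : c (e.symm x) = x := e.apply_symm_apply x
  refine ⟨e.symm.toLinearMap, ⟨mem_centroid_iff.2 fun k T hT x => hinj ?_, fun k x hx => ?_⟩,
    LinearMap.ext he, LinearMap.ext e.symm_apply_apply⟩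
  · rw [LinearEquiv.coe_coe, he, map_mulOps_of_mem_centroidDeg hc hT, he]
  · have hproj : A.proj (g⁻¹ * k) (e.symm x) = e.symm x := hinj <| by
      rw [← HasDegree.proj_apply hc.2, mul_inv_cancel_left, he, proj_of_mem hx]
    rw [LinearEquiv.coe_coe, ← hproj]
    exact proj_mem _ _

include hA in
theorem one_ne_zero : (1 : Module.End F A.carrier) ≠ 0 := by
  have := hA.1
  exact _root_.one_ne_zero

/-- The support of the centroid of a graded-simple algebra. -/
def centroidSupport : Subgroup G where
  carrier := {g | A.centroidDeg g ≠ ⊥}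
  one_mem' := (Submodule.ne_bot_iff _).2 ⟨1, one_mem_centroidDeg, hA.one_ne_zero⟩
  mul_mem' := by
    intro g k hg hk
    obtain ⟨c, hc, hc₀⟩ := (Submodule.ne_bot_iff _).1 hg
    obtain ⟨d, hd, hd₀⟩ := (Submodule.ne_bot_iff _).1 hk
    obtain ⟨x, hx⟩ := DFunLike.ne_iff.1 hd₀
    refine (Submodule.ne_bot_iff _).2 ⟨c * d, mul_mem_centroidDeg hc hd, DFunLike.ne_iff.2 ⟨x, ?_⟩⟩
    exact (map_ne_zero_iff c (hA.injective_of_mem_centroidDeg hc hc₀)).2 hx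
  inv_mem' := by
    intro g hg
    obtain ⟨c, hc, hc₀⟩ := (Submodule.ne_bot_iff _).1 hg
    obtain ⟨d, hd, hcd, -⟩ := hA.exists_inverse hc hc₀
    refine (Submodule.ne_bot_iff _).2 ⟨d, hd, ?_⟩
    rintro rfl
    exact hA.one_ne_zero (hcd.symm.trans (mul_zero c))

end IsGradedSimple

theorem IsGradedCentralSimple.exists_eq_smul (hA : A.IsGradedCentralSimple)
    (hc : c ∈ A.centroidDeg g) (hd : d ∈ A.centroidDeg g) (h₀ : d ≠ 0) : ∃ r : F, c = r • d := by
  obtain ⟨e, he, hde, -⟩ := hA.1.exists_inverse hd h₀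
  have hec := mul_mem_centroidDeg he hc
  rw [inv_mul_cancel, hA.2] at hec
  obtain ⟨r, hr⟩ := Submodule.mem_span_singleton.1 hec
  refine ⟨r, ?_⟩
  rw [← one_mul c, ← hde, mul_assoc, ← hr, mul_smul_comm, mul_one]

end Centroid

/-! ## Twisted covers -/

section TwistedCover

variable {K : Type z} [CommGroup K] {L : Type*} [CommGroup L]
  {φ : G →* K} {ψ : K →* L} {τ : Z2sym G Fˣ} {σ : Z2sym K Fˣ}
  {B : GradedAlg.{u, v, w} F G} {A : GradedAlg.{u, z, x} F K} {D : GradedAlg.{u, _, y} F L}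
  {P : B.carrier →ₗ[F] A.carrier} {Q : A.carrier →ₗ[F] D.carrier}

/-- `P` exhibits `B` as a copy of the loop algebra of `A` along `φ`, twisted by `τ`: the projection
`L_φ^τ(A) → A`, `a ⊗ g ↦ a`, is the model example. For `φ = id` these are the identifications of
`B` with `A^τ`, and in particular the graded isomorphisms for `τ = 1`. -/
structure IsTwistedCover (φ : G →* K) (τ : Z2sym G Fˣ) (B : GradedAlg.{u, v, w} F G)
    (A : GradedAlg.{u, z, x} F K) (P : B.carrier →ₗ[F] A.carrier) : Prop where
  bijOn : ∀ g, Set.BijOn P (B.deg g) (A.deg (φ g))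
  apply_mul : ∀ ⦃g k x y⦄, x ∈ B.deg g → y ∈ B.deg k →
    P (B.mul x y) = (τ.1 g k : F) • A.mul (P x) (P y)

/-- The automorphism multiplying the component of degree `g` by `γ g`. -/
def scale (γ : G → Fˣ) : Module.End F B.carrier :=
  lift fun g => (γ g : F) • (B.deg g).subtype

theorem scale_of_mem (γ : G → Fˣ) {g : G} {x : B.carrier} (hx : x ∈ B.deg g) :
    scale γ x = (γ g : F) • x :=
  lift_of_mem _ hx

theorem scale_mem (γ : G → Fˣ) {g : G} {x : B.carrier} (hx : x ∈ B.deg g) :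
    scale γ x ∈ B.deg g :=
  scale_of_mem γ hx ▸ Submodule.smul_mem _ _ hx

theorem isTwistedCover_scale (γ : G → Fˣ) :
    IsTwistedCover (MonoidHom.id G) (Z2sym.coboundary γ)⁻¹ B B (scale γ) where
  bijOn g := by
    refine ⟨fun x hx => scale_mem γ hx, fun x hx y hy hxy => ?_, fun y hy => ?_⟩
    · rw [scale_of_mem γ hx, scale_of_mem γ hy] at hxy
      exact smul_right_injective _ (γ g).ne_zero hxy
    · have hy' : ((γ g)⁻¹ : Fˣ) • y ∈ B.deg g := Submodule.smul_mem _ _ hy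
      exact ⟨_, hy', (scale_of_mem γ hy').trans (smul_inv_smul (γ g) y)⟩
  apply_mul g k x y hx hy := by
    have hγ : γ (g * k) = (Z2sym.coboundary γ)⁻¹.1 g k * (γ k * γ g) := by
      change _ = (γ g * γ k * (γ (g * k))⁻¹)⁻¹ * _
      rw [mul_inv_rev, inv_inv, mul_assoc, mul_comm (γ k), inv_mul_cancel, mul_one]
    rw [scale_of_mem γ hx, scale_of_mem γ hy, scale_of_mem γ (B.mul_mem hx hy), hγ]
    simp only [map_smul, LinearMap.smul_apply, smul_smul, Units.val_mul]

theorem isTwistedCover_twist (τ : Z2sym G Fˣ) :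
    IsTwistedCover (MonoidHom.id G) τ (B.twist τ) B LinearMap.id :=
  ⟨fun _ => Set.bijOn_id _, fun _ _ _ _ hx hy => B.twistMul_of_mem τ.1 hx hy⟩

theorem isTwistedCover_inv_twist (τ : Z2sym G Fˣ) :
    IsTwistedCover (MonoidHom.id G) τ⁻¹ B (B.twist τ) LinearMap.id := by
  refine ⟨fun _ => Set.bijOn_id _, fun g k x y hx hy => ?_⟩
  change B.mul x y = ((τ.1 g k)⁻¹ : Fˣ) • B.twistMul τ.1 x y
  rw [B.twistMul_of_mem τ.1 hx hy, ← Units.smul_def, inv_smul_smul]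

theorem GradedIso.exists_isTwistedCover {B' : GradedAlg.{u, v, w} F G} (h : B.GradedIso B') :
    ∃ e : B.carrier →ₗ[F] B'.carrier, IsTwistedCover (MonoidHom.id G) 1 B B' e := by
  obtain ⟨e, hmul, hdeg⟩ := h
  refine ⟨e, fun g => ?_, fun g k x y _ _ => ?_⟩
  · rw [MonoidHom.id_apply, ← hdeg]
    exact e.injective.injOn.bijOn_image
  · exact (hmul x y).trans (one_smul F _).symm

namespace IsTwistedCover

theorem gradedIso {B' : GradedAlg.{u, v, w} F G} {e : B.carrier →ₗ[F] B'.carrier}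
    (h : IsTwistedCover (MonoidHom.id G) 1 B B' e) : B.GradedIso B' := by
  refine ⟨LinearEquiv.ofBijective e (bijective_of_components h.bijOn), fun x y => ?_, fun g => ?_⟩
  · have hbilin : B.mul.compr₂ e = B'.mul.compl₁₂ e e := B.bilin_ext fun g k x hx y hy =>
      (h.apply_mul hx hy).trans (one_smul F _)
    exact LinearMap.congr_fun₂ hbilin x y
  · exact SetLike.coe_injective (h.bijOn g).image_eq

theorem comp (hP : IsTwistedCover φ τ B A P) (hQ : IsTwistedCover ψ σ A D Q) :
    IsTwistedCover (ψ.comp φ) (τ * Z2sym.comap Fˣ φ σ) B D (Q ∘ₗ P) where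
  bijOn g := (hQ.bijOn (φ g)).comp (hP.bijOn g)
  apply_mul g k x y hx hy := by
    rw [LinearMap.comp_apply, hP.apply_mul hx hy, map_smul,
      hQ.apply_mul ((hP.bijOn g).mapsTo hx) ((hP.bijOn k).mapsTo hy), smul_smul, ← Units.val_mul]
    rfl

variable (h : IsTwistedCover φ τ B A P)

include h

theorem exists_mulOps {k : G} {T : Module.End F B.carrier} (hT : T ∈ B.mulOps k) :
    ∃ T' ∈ A.mulOps (φ k), ∀ ⦃g⦄, ∀ x ∈ B.deg g, P (T x) = (τ.1 k g : F) • T' (P x) := by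
  obtain ⟨b, hb, rfl | rfl⟩ := hT
  · exact ⟨_, mul_mem_mulOps ((h.bijOn k).mapsTo hb), fun g x hx => h.apply_mul hb hx⟩
  · refine ⟨_, flip_mem_mulOps ((h.bijOn k).mapsTo hb), fun g x hx => ?_⟩
    rw [Z2sym.symm τ]
    exact h.apply_mul hx hb

theorem exists_lift_mulOps {k : G} {T : Module.End F A.carrier} (hT : T ∈ A.mulOps (φ k)) :
    ∃ T' ∈ B.mulOps k, ∀ ⦃g⦄, ∀ x ∈ B.deg g, P (T' x) = (τ.1 k g : F) • T (P x) := by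
  obtain ⟨a, ha, hT⟩ := hT
  obtain ⟨b, hb, rfl⟩ := (h.bijOn k).surjOn ha
  obtain rfl | rfl := hT
  · exact ⟨_, mul_mem_mulOps hb, fun g x hx => h.apply_mul hb hx⟩
  · refine ⟨_, flip_mem_mulOps hb, fun g x hx => ?_⟩
    rw [Z2sym.symm τ]
    exact h.apply_mul hx hb

/-- The isomorphism of a component of the cover with a component of the base. -/
def degEquiv {g : G} {q : K} (hq : φ g = q) : B.deg g ≃ₗ[F] A.deg q :=
  LinearEquiv.ofBijective (P.restrict fun _ hx => hq ▸ (h.bijOn g).mapsTo hx)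
    (by subst hq; exact (h.bijOn g).bijective)

theorem apply_degEquiv_symm {g : G} {q : K} (hq : φ g = q) (a : A.deg q) :
    P ((h.degEquiv hq).symm a) = a :=
  congrArg Subtype.val ((h.degEquiv hq).apply_symm_apply a)

theorem exists_linear_lift {C : GradedAlg.{u, v, y} F G} {k : G} (f : C.carrier →ₗ[F] A.carrier)
    (hf : ∀ ⦃g⦄, ∀ x ∈ C.deg g, f x ∈ A.deg (φ (k * g))) :
    ∃ f' : C.carrier →ₗ[F] B.carrier, HasDegree f' k ∧ ∀ x, P (f' x) = f x := by
  let f' : C.carrier →ₗ[F] B.carrier := lift fun g =>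
    (B.deg (k * g)).subtype ∘ₗ (h.degEquiv rfl).symm.toLinearMap ∘ₗ f.restrict (@hf g)
  refine ⟨f', fun g x hx => ?_, LinearMap.congr_fun (f := P ∘ₗ f') (linearMap_ext fun g x hx => ?_)⟩
  · rw [lift_of_mem _ hx]
    exact Subtype.prop _
  · rw [LinearMap.comp_apply, lift_of_mem _ hx]
    exact h.apply_degEquiv_symm rfl _

theorem surjective (hφ : Function.Surjective φ) : Function.Surjective P :=
  LinearMap.range_eq_top.1 <| eq_top_of_deg_le fun q a ha => by
    obtain ⟨g, rfl⟩ := hφ q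
    exact ((h.bijOn g).surjOn ha).imp fun _ hx => hx.2

theorem exists_descent {V : Type*} [AddCommGroup V] [Module F V] (hφ : Function.Surjective φ)
    (f : B.carrier →ₗ[F] V)
    (hf : ∀ g ∈ φ.ker, ∀ k, ∀ x ∈ B.deg k, ∀ y ∈ B.deg (g * k), P y = P x → f y = f x) :
    ∃ f' : A.carrier →ₗ[F] V, ∀ x, f' (P x) = f x := by
  choose r hr using hφ
  let f' : A.carrier →ₗ[F] V := lift fun q =>
    f ∘ₗ (B.deg (r q)).subtype ∘ₗ (h.degEquiv (hr q)).symm.toLinearMap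
  refine ⟨f', LinearMap.congr_fun (f := f' ∘ₗ P) (linearMap_ext fun g x hx => ?_)⟩
  rw [LinearMap.comp_apply, lift_of_mem _ ((h.bijOn g).mapsTo hx)]
  refine (hf (g * (r (φ g))⁻¹) ?_ (r (φ g)) _ (Subtype.prop _) x ?_ ?_).symm
  · rw [MonoidHom.mem_ker, map_mul, map_inv, hr, mul_inv_cancel]
  · rwa [inv_mul_cancel_right]
  · exact (h.apply_degEquiv_symm (hr _) ⟨P x, (h.bijOn g).mapsTo hx⟩).symm

theorem gradedIso_of_cover {B' : GradedAlg.{u, v, w} F G} {P' : B'.carrier →ₗ[F] A.carrier}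
    (h' : IsTwistedCover φ τ B' A P') : B'.GradedIso B := by
  obtain ⟨e, hdeg, he⟩ := h.exists_linear_lift (k := 1) P' fun g x hx =>
    (one_mul g).symm ▸ (h'.bijOn g).mapsTo hx
  have hmem {g : G} {x : B'.carrier} (hx : x ∈ B'.deg g) : e x ∈ B.deg g :=
    one_mul g ▸ hdeg x hx
  refine IsTwistedCover.gradedIso (e := e) ⟨fun g => ?_, fun g k x y hx hy => ?_⟩
  · refine ⟨fun x => hmem, fun x hx y hy hxy => ?_, fun y hy => ?_⟩
    · exact (h'.bijOn g).injOn hx hy (by rw [← he, hxy, he])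
    · obtain ⟨x, hx, hxy⟩ := (h'.bijOn g).surjOn ((h.bijOn g).mapsTo hy)
      exact ⟨x, hx, (h.bijOn g).injOn (hmem hx) hy ((he x).trans hxy)⟩
  · refine (h.bijOn (g * k)).injOn (hmem (B'.mul_mem hx hy)) ?_ ?_
    · exact Submodule.smul_mem _ _ (B.mul_mem (hmem hx) (hmem hy))
    · rw [he, h'.apply_mul hx hy, map_smul, h.apply_mul (hmem hx) (hmem hy), he, he]
      exact (one_smul F _).symm

end IsTwistedCover

end TwistedCover

/-! ## Graded ideals of a twisted cover -/

section GradedIdeals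

variable {K : Type z} [CommGroup K]
  {φ : G →* K} {τ : Z2sym G Fˣ} {B : GradedAlg.{u, v, w} F G} {A : GradedAlg.{u, z, x} F K}
  {P : B.carrier →ₗ[F] A.carrier} {g k : G}

/-- The largest family of homogeneous subspaces of the base of a cover `P` that is covered by the
family `S` of homogeneous subspaces of the cover: a homogeneous element belongs to it when all its
homogeneous preimages belong to `S`. -/
def descendFamily (φ : G →* K) (P : B.carrier →ₗ[F] A.carrier) (S : G → Submodule F B.carrier)
    (q : K) : Submodule F A.carrier :=
  A.deg q ⊓ ⨅ (g) (_ : φ g = q), (S g).map P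

theorem mem_descendFamily {S : G → Submodule F B.carrier} {q : K} {a : A.carrier} :
    a ∈ descendFamily φ P S q ↔ a ∈ A.deg q ∧ ∀ g, φ g = q → ∃ x ∈ S g, P x = a := by
  simp only [descendFamily, Submodule.mem_inf, Submodule.mem_iInf, Submodule.mem_map]

namespace IsTwistedCover

variable (h : IsTwistedCover φ τ B A P) {S : G → Submodule F B.carrier}

include h

theorem apply_ne_zero {x : B.carrier} (hx : x ∈ B.deg g) (h₀ : x ≠ 0) : P x ≠ 0 := fun h0 =>
  h₀ ((h.bijOn g).injOn hx (zero_mem _) (h0.trans (map_zero P).symm))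

theorem mulOps_apply_mem_descendFamily {x : B.carrier}
    (hx : x ∈ B.deg g) (hS : ∀ l, ∀ T ∈ B.mulOps l, T x ∈ S (l * g)) {q : K}
    {T : Module.End F A.carrier} (hT : T ∈ A.mulOps q) :
    T (P x) ∈ descendFamily φ P S (q * φ g) := by
  refine mem_descendFamily.2 ⟨hasDegree_of_mem_mulOps hT _ ((h.bijOn g).mapsTo hx), fun k hk => ?_⟩
  have hq : φ (k * g⁻¹) = q := by rw [map_mul, hk, map_inv, mul_inv_cancel_right]
  obtain ⟨T', hT', hPT⟩ := h.exists_lift_mulOps (hq ▸ hT)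
  refine ⟨((τ.1 (k * g⁻¹) g)⁻¹ : Fˣ) • T' x, Submodule.smul_mem _ _ ?_, ?_⟩
  · simpa only [inv_mul_cancel_right] using hS _ T' hT'
  · rw [Units.smul_def, map_smul, hPT x hx, ← Units.smul_def, ← Units.smul_def, inv_smul_smul]

theorem le_of_forall_mem_descendFamily (hS : ∀ g, S g ≤ B.deg g)
    (hg : ∀ x ∈ B.deg g, P x ∈ descendFamily φ P S (φ g)) :
    B.deg g ≤ S g := fun x hx => by
  obtain ⟨y, hy, hyx⟩ := (mem_descendFamily.1 (hg x hx)).2 g rfl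
  exact (h.bijOn g).injOn (hS g hy) hx hyx ▸ hy

theorem square_eq_top (hφ : Function.Surjective φ) (hA : A.square = ⊤) : B.square = ⊤ := by
  refine square_eq_top_iff.2 fun I hI => ?_
  let S (g : G) : Submodule F B.carrier := I ⊓ B.deg g
  have htop : ⨆ q, descendFamily φ P S q = ⊤ := square_eq_top_iff.1 hA _ fun q T hT r a ha => by
    obtain ⟨g, rfl⟩ := hφ r
    obtain ⟨x, hx, rfl⟩ := (h.bijOn g).surjOn ha
    refine Submodule.mem_iSup_of_mem _ <|
      h.mulOps_apply_mem_descendFamily hx (fun l T hT => ?_) hT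
    exact ⟨hI l T hT g x hx, hasDegree_of_mem_mulOps hT x hx⟩
  have hle (g : G) : B.deg g ≤ S g := h.le_of_forall_mem_descendFamily (fun _ => inf_le_right)
    fun x hx => mem_of_mem_iSup (S := descendFamily φ P S) (fun _ => inf_le_left)
      (htop.ge Submodule.mem_top) ((h.bijOn g).mapsTo hx)
  exact eq_top_of_deg_le fun g => (hle g).trans inf_le_left

theorem isGradedSimple (hφ : Function.Surjective φ) (hA : A.IsGradedSimple) :
    B.IsGradedSimple := by
  have := hA.1
  refine isGradedSimple_of_isIdealFamily (h.surjective hφ).nontrivial (h.square_eq_top hφ hA.2.1)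
    fun S hS => ?_
  have hdescend : A.IsIdealFamily (descendFamily φ P S) := by
    refine ⟨fun _ => inf_le_left, fun q T hT r a ha => ?_⟩
    obtain ⟨g, rfl⟩ := hφ r
    obtain ⟨x, hx, rfl⟩ := (mem_descendFamily.1 ha).2 g rfl
    exact h.mulOps_apply_mem_descendFamily (hS.1 g hx) (fun l T hT => hS.2 l T hT g x hx) hT
  rcases hA.eq_bot_or_eq_deg hdescend with hbot | htop
  · refine .inl fun g => (Submodule.eq_bot_iff _).2 fun x hx => ?_
    have hx' := hS.1 g hx
    refine (h.bijOn g).injOn hx' (zero_mem _) ?_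
    rw [map_zero]
    refine hA.eq_zero_of_mulOps ((h.bijOn g).mapsTo hx') fun q T hT => ?_
    refine (Submodule.eq_bot_iff _).1 (hbot (q * φ g)) _ ?_
    exact h.mulOps_apply_mem_descendFamily hx' (fun l T hT => hS.2 l T hT g x hx) hT
  · exact .inr fun g => h.le_of_forall_mem_descendFamily hS.1 fun x hx =>
      (htop (φ g)).ge ((h.bijOn g).mapsTo hx)

theorem square_eq_top_base (hφ : Function.Surjective φ) (hB : B.square = ⊤) : A.square = ⊤ := by
  refine square_eq_top_iff.2 fun I hI => ?_
  have htop : I.comap P = ⊤ := square_eq_top_iff.1 hB _ fun k T hT g x hx => by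
    obtain ⟨T', hT', hPT⟩ := h.exists_mulOps hT
    rw [Submodule.mem_comap, hPT x hx]
    exact I.smul_mem _ (hI _ T' hT' _ _ ((h.bijOn g).mapsTo hx))
  refine eq_top_iff.2 fun a _ => ?_
  obtain ⟨x, rfl⟩ := h.surjective hφ a
  exact (htop ▸ trivial : x ∈ I.comap P)

theorem isIdealFamily_comap {S : K → Submodule F A.carrier} (hS : A.IsIdealFamily S) :
    B.IsIdealFamily fun g => (S (φ g)).comap P ⊓ B.deg g := by
  refine ⟨fun _ => inf_le_right, fun k T hT g x hx => ⟨?_, hasDegree_of_mem_mulOps hT x hx.2⟩⟩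
  obtain ⟨T', hT', hPT⟩ := h.exists_mulOps hT
  change P (T x) ∈ S (φ (k * g))
  rw [hPT x hx.2, map_mul]
  exact Submodule.smul_mem _ _ (hS.2 _ T' hT' _ _ hx.1)

theorem isGradedSimple_base (hφ : Function.Surjective φ) (hB : B.IsGradedSimple) :
    A.IsGradedSimple := by
  obtain ⟨g, x, hx, hx₀⟩ := exists_homogeneous_apply_ne_zero hB.one_ne_zero
  refine isGradedSimple_of_isIdealFamily ⟨P x, 0, h.apply_ne_zero hx hx₀⟩
    (h.square_eq_top_base hφ hB.2.1) fun S hS => ?_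
  rcases hB.eq_bot_or_eq_deg (h.isIdealFamily_comap hS) with hbot | htop
  · refine .inl fun q => (Submodule.eq_bot_iff _).2 fun a ha => ?_
    obtain ⟨g, rfl⟩ := hφ q
    obtain ⟨x, hx, rfl⟩ := (h.bijOn g).surjOn (hS.1 _ ha)
    rw [(Submodule.eq_bot_iff _).1 (hbot g) x ⟨ha, hx⟩, map_zero]
  · refine .inr fun q a ha => ?_
    obtain ⟨g, rfl⟩ := hφ q
    obtain ⟨x, hx, rfl⟩ := (h.bijOn g).surjOn ha
    exact inf_eq_right.1 (htop g) hx

end IsTwistedCover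

end GradedIdeals

/-! ## The centroid of a twisted cover -/

section CentroidOfCover

variable {K : Type z} [CommGroup K]
  {φ : G →* K} {τ : Z2sym G Fˣ} {B : GradedAlg.{u, v, w} F G} {A : GradedAlg.{u, z, x} F K}
  {P : B.carrier →ₗ[F] A.carrier} {g k : G}

namespace IsTwistedCover

section Lift

variable (h : IsTwistedCover φ τ B A P)

include h

theorem exists_centroid_lift {c : Module.End F A.carrier} (hc : c ∈ A.centroidDeg (φ g)) :
    ∃ c' ∈ B.centroidDeg g, ∀ ⦃k⦄, ∀ x ∈ B.deg k, P (c' x) = (τ.1 g k : F) • c (P x) := by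
  have hcP ⦃k : G⦄ (x : B.carrier) (hx : x ∈ B.deg k) : c (P x) ∈ A.deg (φ (g * k)) :=
    map_mul φ g k ▸ hc.2 _ _ ((h.bijOn k).mapsTo hx)
  obtain ⟨c', hdeg, hPc⟩ := h.exists_linear_lift (c ∘ₗ P ∘ₗ scale (τ.1 g))
    fun k x hx => hcP _ (scale_mem _ hx)
  have hPc' ⦃k : G⦄ (x : B.carrier) (hx : x ∈ B.deg k) : P (c' x) = (τ.1 g k : F) • c (P x) := by
    rw [hPc, LinearMap.comp_apply, LinearMap.comp_apply, scale_of_mem _ hx, map_smul, map_smul]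
  refine ⟨c', mem_centroidDeg hdeg fun k T hT l x hx => ?_, hPc'⟩
  obtain ⟨T', hT', hPT⟩ := h.exists_mulOps hT
  have hTx := hasDegree_of_mem_mulOps hT x hx
  have hcx := hdeg x hx
  refine (h.bijOn (g * (k * l))).injOn (hdeg _ hTx) ?_ ?_
  · rw [mul_left_comm]
    exact hasDegree_of_mem_mulOps hT _ hcx
  · rw [hPc' _ hTx, hPT x hx, hPT _ hcx, hPc' x hx, map_smul, map_smul, smul_smul, smul_smul,
      map_mulOps_of_mem_centroidDeg hc hT', ← Units.val_mul, ← Units.val_mul,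
      Z2sym.cocycle_left_comm]

end Lift

section Shift

/-- The centroid element of degree `g ∈ ker φ` over the identity of the base; on the loop algebra it
is `a ⊗ k ↦ a ⊗ gk`, up to the twist. -/
def shift (h : IsTwistedCover φ τ B A P) (g : φ.ker) : Module.End F B.carrier :=
  (h.exists_centroid_lift (c := 1) (g.2.symm ▸ one_mem_centroidDeg)).choose

variable (h : IsTwistedCover φ τ B A P)

theorem shift_mem (g : φ.ker) : h.shift g ∈ B.centroidDeg g :=
  (h.exists_centroid_lift (c := 1) (g.2.symm ▸ one_mem_centroidDeg)).choose_spec.1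

theorem apply_shift (g : φ.ker) {x : B.carrier} (hx : x ∈ B.deg k) :
    P (h.shift g x) = (τ.1 g k : F) • P x :=
  (h.exists_centroid_lift (c := 1) (g.2.symm ▸ one_mem_centroidDeg)).choose_spec.2 x hx

theorem exists_descent_of_apply_shift {V : Type*} [AddCommGroup V] [Module F V]
    (hφ : Function.Surjective φ) (f : B.carrier →ₗ[F] V)
    (hf : ∀ g : φ.ker, ∀ k, ∀ x ∈ B.deg k, f (h.shift g x) = (τ.1 g k : F) • f x) :
    ∃ f' : A.carrier →ₗ[F] V, ∀ x, f' (P x) = f x := by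
  refine h.exists_descent hφ f fun g hg k x hx y hy hyx => ?_
  have hshift : h.shift ⟨g, hg⟩ x = (τ.1 g k : F) • y :=
    (h.bijOn _).injOn ((h.shift_mem _).2 k x hx) (Submodule.smul_mem _ _ hy)
      (by rw [h.apply_shift _ hx, map_smul, hyx])
  have hfx := hf ⟨g, hg⟩ k x hx
  rw [hshift, map_smul] at hfx
  exact smul_right_injective V (τ.1 g k).ne_zero hfx

theorem shift_mul_shift (g k : φ.ker) :
    h.shift g * h.shift k = (τ.1 g k : F) • h.shift (g * k) := by
  refine linearMap_ext fun l x hx => ?_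
  have hkx := (h.shift_mem k).2 l x hx
  have hgkx := (h.shift_mem (g * k)).2 l x hx
  refine (h.bijOn (g * (k * l))).injOn ((h.shift_mem g).2 _ _ hkx) ?_ ?_
  · exact Submodule.smul_mem _ _ (mul_assoc (g : G) k l ▸ hgkx)
  · change P (h.shift g (h.shift k x)) = P ((τ.1 g k : F) • h.shift (g * k) x)
    rw [h.apply_shift g hkx, h.apply_shift k hx, map_smul, h.apply_shift _ hx, smul_smul,
      smul_smul, ← Units.val_mul, ← Units.val_mul, Subgroup.coe_mul, Z2sym.cocycle]

theorem shift_ne_zero [Nontrivial B.carrier] (g : φ.ker) : h.shift g ≠ 0 := fun h0 => by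
  obtain ⟨k, x, hx, hx₀⟩ := exists_homogeneous_apply_ne_zero (one_ne_zero' (Module.End F B.carrier))
  have hPx := h.apply_shift g hx
  rw [h0, LinearMap.zero_apply, map_zero] at hPx
  exact h.apply_ne_zero hx hx₀ ((smul_eq_zero.1 hPx.symm).resolve_left (τ.1 g k).ne_zero)

end Shift

section Descent

variable (h : IsTwistedCover φ τ B A P)

include h

theorem mem_centroidDeg_of_apply_eq_smul (hφ : Function.Surjective φ) {c : Module.End F B.carrier}
    (hc : c ∈ B.centroidDeg g) {c' : Module.End F A.carrier}
    (hPc : ∀ ⦃k⦄, ∀ x ∈ B.deg k, P (c x) = (τ.1 g k : F) • c' (P x)) :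
    c' ∈ A.centroidDeg (φ g) := by
  refine mem_centroidDeg (fun q a ha => ?_) fun q T hT r a ha => ?_
  · obtain ⟨k, rfl⟩ := hφ q
    obtain ⟨x, hx, rfl⟩ := (h.bijOn k).surjOn ha
    rw [← (A.deg _).smul_mem_iff (τ.1 g k).ne_zero, ← hPc x hx, ← map_mul]
    exact (h.bijOn _).mapsTo (hc.2 k x hx)
  · obtain ⟨k, rfl⟩ := hφ q
    obtain ⟨l, rfl⟩ := hφ r
    obtain ⟨x, hx, rfl⟩ := (h.bijOn l).surjOn ha
    obtain ⟨T', hT', hPT⟩ := h.exists_lift_mulOps hT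
    have hcT := congrArg P (map_mulOps_of_mem_centroidDeg hc hT' x)
    rw [hPc _ (hasDegree_of_mem_mulOps hT' x hx), hPT x hx, hPT _ (hc.2 l x hx), hPc x hx,
      map_smul, map_smul, smul_smul, smul_smul, ← Units.val_mul, ← Units.val_mul,
      Z2sym.cocycle_left_comm] at hcT
    exact smul_right_injective _ (Units.ne_zero _) hcT

/-- The centroid of `B` is commutative, so its elements commute with the shifts. -/
theorem exists_centroid_descent (hφ : Function.Surjective φ) (hB : B.square = ⊤)
    {c : Module.End F B.carrier} (hc : c ∈ B.centroidDeg g) :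
    ∃ c' ∈ A.centroidDeg (φ g), ∀ ⦃k⦄, ∀ x ∈ B.deg k, P (c x) = (τ.1 g k : F) • c' (P x) := by
  let f := P ∘ₗ c ∘ₗ scale (τ.1 g)⁻¹
  have hf ⦃k : G⦄ (x : B.carrier) (hx : x ∈ B.deg k) : P (c x) = (τ.1 g k : F) • f x := by
    change _ = _ • P (c (scale _ x))
    rw [scale_of_mem _ hx, map_smul, map_smul, smul_smul, Pi.inv_apply, Units.mul_inv, one_smul]
  have hshift (l : φ.ker) (k : G) (x : B.carrier) (hx : x ∈ B.deg k) :
      f (h.shift l x) = (τ.1 l k : F) • f x := by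
    have hcomm : c (h.shift l x) = h.shift l (c x) :=
      LinearMap.congr_fun (mul_comm_of_mem_centroid hB hc.1 (h.shift_mem l).1) x
    refine smul_right_injective _ (τ.1 g (l * k)).ne_zero ?_
    beta_reduce
    rw [← hf _ ((h.shift_mem l).2 k x hx), hcomm, h.apply_shift l (hc.2 k x hx), hf x hx,
      smul_smul, smul_smul, ← Units.val_mul, ← Units.val_mul, Z2sym.cocycle_left_comm]
  obtain ⟨c', hc'⟩ := h.exists_descent_of_apply_shift hφ f hshift
  have hPc ⦃k : G⦄ (x : B.carrier) (hx : x ∈ B.deg k) : P (c x) = (τ.1 g k : F) • c' (P x) := by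
    rw [hc', hf x hx]
  exact ⟨c', h.mem_centroidDeg_of_apply_eq_smul hφ hc hPc, hPc⟩

end Descent

section CentralSimple

variable (h : IsTwistedCover φ τ B A P)

include h

theorem exists_apply_eq_smul (hφ : Function.Surjective φ) (hA : A.IsCentralSimple)
    {c : Module.End F B.carrier} (hc : c ∈ B.centroidDeg g) :
    ∃ r : F, ∀ ⦃k⦄, ∀ x ∈ B.deg k, P (c x) = ((τ.1 g k : F) * r) • P x := by
  obtain ⟨c', hc', hPc⟩ := h.exists_centroid_descent hφ (h.square_eq_top hφ hA.1.2.1) hc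
  obtain ⟨r, rfl⟩ := Submodule.mem_span_singleton.1 (hA.2.le (show c' ∈ A.centroid from hc'.1))
  exact ⟨r, fun k x hx => (hPc x hx).trans (smul_smul _ r (P x))⟩

theorem isGradedCentralSimple (hφ : Function.Surjective φ) (hA : A.IsCentralSimple) :
    B.IsGradedCentralSimple := by
  have hsimple : A.IsGradedSimple := ⟨hA.1.1, hA.1.2.1, fun I hI => hA.1.2.2 I hI.1⟩
  refine ⟨h.isGradedSimple hφ hsimple, le_antisymm (fun c hc => ?_) ?_⟩
  · obtain ⟨r, hr⟩ := h.exists_apply_eq_smul hφ hA hc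
    refine Submodule.mem_span_singleton.2 ⟨(τ.1 1 1 : F) * r, linearMap_ext fun k x hx => ?_⟩
    refine (h.bijOn k).injOn (Submodule.smul_mem _ _ hx) (one_mul k ▸ hc.2 k x hx) ?_
    rw [hr x hx, Z2sym.apply_one_left τ k]
    exact map_smul P _ x
  · exact (Submodule.span_singleton_le_iff_mem _ _).2 one_mem_centroidDeg

theorem centroidDeg_ne_bot_iff (hφ : Function.Surjective φ) (hA : A.IsCentralSimple) :
    B.centroidDeg g ≠ ⊥ ↔ g ∈ φ.ker := by
  refine ⟨fun hg => ?_, fun hg => ?_⟩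
  · obtain ⟨c, hc, hc₀⟩ := (Submodule.ne_bot_iff _).1 hg
    obtain ⟨r, hr⟩ := h.exists_apply_eq_smul hφ hA hc
    obtain ⟨k, x, hx, hcx⟩ := exists_homogeneous_apply_ne_zero hc₀
    by_contra hne
    have hPcx := (h.bijOn _).mapsTo (hc.2 k x hx)
    refine h.apply_ne_zero (hc.2 k x hx) hcx (eq_zero_of_mem_of_mem hPcx (k := φ k) ?_ ?_)
    · exact hr x hx ▸ Submodule.smul_mem _ _ ((h.bijOn k).mapsTo hx)
    · rwa [map_mul, Ne, mul_eq_right]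
  · have := (h.isGradedCentralSimple hφ hA).1.1
    exact (Submodule.ne_bot_iff _).2 ⟨_, h.shift_mem ⟨g, hg⟩, h.shift_ne_zero _⟩

end CentralSimple

end IsTwistedCover

end CentroidOfCover

/-! ## From graded simplicity to simplicity -/

section Simplicity

variable {A : GradedAlg.{u, v, w} F G}

theorem IsGradedSimple.exists_mem_proj_eq (hA : A.IsGradedSimple) {Z : G → Submodule F A.carrier}
    (hZ : ∀ k, ∀ T ∈ A.mulOps k, ∀ g, ∀ z ∈ Z g, T z ∈ Z (k * g)) {p : G} {a : A.carrier}
    (ha : a ∈ Z p) (ha₀ : A.proj p a ≠ 0) {g : G} {x : A.carrier} (hx : x ∈ A.deg g) :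
    ∃ z ∈ Z g, A.proj g z = x := by
  have hS : A.IsIdealFamily fun g => (Z g).map (A.proj g) := by
    refine ⟨fun g => Submodule.map_le_iff_le_comap.2 fun z _ => proj_mem g z, ?_⟩
    rintro k T hT g _ ⟨z, hz, rfl⟩
    exact ⟨T z, hZ k T hT g z hz, (hasDegree_of_mem_mulOps hT).proj_apply g z⟩
  rcases hA.eq_bot_or_eq_deg hS with hbot | htop
  · exact absurd ((Submodule.eq_bot_iff _).1 (hbot p) _ ⟨a, ha, rfl⟩) ha₀
  · exact (htop g).ge hx

/-- An ideal that is nowhere homogeneous yields such a family `Z`, and the element `d` relates two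
components of its members. -/
theorem exists_mem_centroidDeg_of_bijective_proj {Z : G → Submodule F A.carrier}
    (hZ : ∀ k, ∀ T ∈ A.mulOps k, ∀ g, ∀ z ∈ Z g, T z ∈ Z (k * g))
    (hinj : ∀ g, ∀ z ∈ Z g, A.proj g z = 0 → z = 0)
    (hsurj : ∀ g, ∀ x ∈ A.deg g, ∃ z ∈ Z g, A.proj g z = x) (k : G) :
    ∃ d ∈ A.centroidDeg k, ∀ g, ∀ z ∈ Z g, d (A.proj g z) = A.proj (k * g) z := by
  let projEquiv (g : G) : Z g ≃ₗ[F] A.deg g :=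
    LinearEquiv.ofBijective ((A.proj g).restrict fun z _ => proj_mem g z)
      ⟨(injective_iff_map_eq_zero _).2 fun z hz =>
          Subtype.ext (hinj g z z.2 (congrArg Subtype.val hz)),
        fun x => (hsurj g x x.2).elim fun z hz => ⟨⟨z, hz.1⟩, Subtype.ext hz.2⟩⟩
  let d : Module.End F A.carrier := lift fun g =>
    A.proj (k * g) ∘ₗ (Z g).subtype ∘ₗ (projEquiv g).symm.toLinearMap
  have hd (g : G) (z : A.carrier) (hz : z ∈ Z g) : d (A.proj g z) = A.proj (k * g) z := by
    rw [lift_of_mem _ (proj_mem g z)]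
    change A.proj (k * g) ((projEquiv g).symm (projEquiv g ⟨z, hz⟩)) = _
    rw [LinearEquiv.symm_apply_apply]
  refine ⟨d, mem_centroidDeg (fun g x hx => ?_) fun l T hT g x hx => ?_, hd⟩
  · obtain ⟨z, hz, rfl⟩ := hsurj g x hx
    exact hd g z hz ▸ proj_mem _ z
  · obtain ⟨z, hz, rfl⟩ := hsurj g x hx
    have hTdeg := hasDegree_of_mem_mulOps hT
    rw [← hTdeg.proj_apply, hd _ _ (hZ l T hT g z hz), hd g z hz, mul_left_comm, hTdeg.proj_apply]

/-- The elements `z` of `I` such that the support of `g⁻¹z` is contained in that of `p⁻¹a`. -/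
def supportTranslate (I : Submodule F A.carrier) (p : G) (a : A.carrier) (g : G) :
    Submodule F A.carrier :=
  I ⊓ ⨅ r, ⨅ _ : A.proj (p * r) a = 0, LinearMap.ker (A.proj (g * r))

section SupportTranslate

variable {I : Submodule F A.carrier} {p g : G} {a z : A.carrier}

theorem mem_supportTranslate : z ∈ supportTranslate I p a g ↔
    z ∈ I ∧ ∀ r, A.proj (p * r) a = 0 → A.proj (g * r) z = 0 := by
  simp only [supportTranslate, Submodule.mem_inf, Submodule.mem_iInf, LinearMap.mem_ker]

theorem mulOps_apply_mem_supportTranslate (hI : A.IsIdeal I) {k : G}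
    {T : Module.End F A.carrier} (hT : T ∈ A.mulOps k) (hz : z ∈ supportTranslate I p a g) :
    T z ∈ supportTranslate I p a (k * g) := by
  rw [mem_supportTranslate] at hz ⊢
  refine ⟨isIdeal_iff.1 hI k T hT z hz.1, fun r hr => ?_⟩
  rw [mul_assoc, (hasDegree_of_mem_mulOps hT).proj_apply, hz.2 r hr, map_zero]

theorem card_support_lt_of_mem_supportTranslate (hp : A.proj p a ≠ 0)
    (hz : z ∈ supportTranslate I p a g) (hz₀ : A.proj g z = 0) :
    (A.support z).card < (A.support a).card := by
  classical
  have himage : (A.support z).image (fun k => p * (g⁻¹ * k)) ⊆ (A.support a).erase p := by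
    refine Finset.image_subset_iff.2 fun k hk => ?_
    rw [mem_support] at hk
    refine Finset.mem_erase.2 ⟨fun hkp => hk ?_, mem_support.2 fun hka => hk ?_⟩
    · rwa [← inv_mul_eq_one.1 (mul_eq_left.1 hkp)]
    · simpa only [mul_inv_cancel_left] using (mem_supportTranslate.1 hz).2 _ hka
  calc (A.support z).card = ((A.support z).image fun k => p * (g⁻¹ * k)).card :=
        (Finset.card_image_of_injective _
          ((mul_right_injective p).comp (mul_right_injective g⁻¹))).symm
    _ ≤ ((A.support a).erase p).card := Finset.card_le_card himage
    _ < (A.support a).card := Finset.card_erase_lt_of_mem (mem_support.2 hp)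

end SupportTranslate

theorem IsGradedSimple.eq_top_of_mem (hA : A.IsGradedSimple) {I : Submodule F A.carrier}
    (hI : A.IsIdeal I) {g : G} {x : A.carrier} (hx : x ∈ A.deg g) (hxI : x ∈ I) (hx₀ : x ≠ 0) :
    I = ⊤ := by
  rcases hA.eq_bot_or_eq_deg (isIdealFamily_inf hI) with hbot | htop
  · exact absurd ((Submodule.eq_bot_iff _).1 (hbot g) x ⟨hxI, hx⟩) hx₀
  · exact eq_top_of_deg_le fun k => inf_eq_right.1 (htop k)

/-- A nonzero element `a` of an ideal with support of minimal size is homogeneous: a second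
component of `a` would depend on the first through a centroid element of nontrivial degree. -/
theorem IsGradedSimple.isSimple (hA : A.IsGradedSimple)
    (hC : ∀ g, g ≠ 1 → A.centroidDeg g = ⊥) : A.IsSimple := by
  refine ⟨hA.1, hA.2.1, fun I hI => or_iff_not_imp_left.2 fun hbot => ?_⟩
  obtain ⟨a, ⟨haI, ha₀⟩, hmin⟩ := exists_minimalFor_of_wellFoundedLT
    (fun a => a ∈ I ∧ a ≠ 0) (fun a => (A.support a).card) ((Submodule.ne_bot_iff _).1 hbot)
  obtain ⟨p, hp⟩ : ∃ p, A.proj p a ≠ 0 := not_forall.1 fun h => ha₀ (eq_zero_of_proj h)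
  have haZ : a ∈ supportTranslate I p a p := mem_supportTranslate.2 ⟨haI, fun _ => id⟩
  have hZ (k : G) (T) (hT : T ∈ A.mulOps k) (g : G) (z) (hz : z ∈ supportTranslate I p a g) :
      T z ∈ supportTranslate I p a (k * g) := mulOps_apply_mem_supportTranslate hI hT hz
  have hinj (g : G) (z : A.carrier) (hz : z ∈ supportTranslate I p a g) (hz₀ : A.proj g z = 0) :
      z = 0 := by
    by_contra hne
    have hlt := card_support_lt_of_mem_supportTranslate hp hz hz₀
    exact hlt.not_ge (hmin ⟨(mem_supportTranslate.1 hz).1, hne⟩ hlt.le)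
  have hcomp (q : G) (hq : q ≠ p) : A.proj q a = 0 := by
    obtain ⟨d, hd, hproj⟩ := exists_mem_centroidDeg_of_bijective_proj hZ hinj
      (fun g x hx => hA.exists_mem_proj_eq hZ haZ hp hx) (q * p⁻¹)
    obtain rfl : d = 0 := by rwa [hC _ (mt mul_inv_eq_one.1 hq)] at hd
    simpa only [inv_mul_cancel_right, LinearMap.zero_apply] using (hproj p a haZ).symm
  exact hA.eq_top_of_mem hI (mem_deg_of_proj_eq_zero hcomp) haI ha₀

theorem exists_mem_centroidDeg_proj {c : Module.End F A.carrier} (hc : c ∈ A.centroid) (g : G) :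
    ∃ d ∈ A.centroidDeg g, ∀ k, ∀ x ∈ A.deg k, d x = A.proj (g * k) (c x) := by
  let d : Module.End F A.carrier := lift fun k => A.proj (g * k) ∘ₗ c ∘ₗ (A.deg k).subtype
  have hd (k : G) (x : A.carrier) (hx : x ∈ A.deg k) : d x = A.proj (g * k) (c x) :=
    lift_of_mem _ hx
  refine ⟨d, mem_centroidDeg (fun k x hx => hd k x hx ▸ proj_mem _ _) fun k T hT l x hx => ?_, hd⟩
  have hTdeg := hasDegree_of_mem_mulOps hT
  rw [hd _ _ (hTdeg x hx), hd l x hx, mem_centroid_iff.1 hc k T hT, mul_left_comm,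
    hTdeg.proj_apply]

theorem IsGradedCentralSimple.isCentralSimple (hA : A.IsGradedCentralSimple)
    (hC : ∀ g, g ≠ 1 → A.centroidDeg g = ⊥) : A.IsCentralSimple := by
  refine ⟨hA.1.isSimple hC, le_antisymm (fun c hc => ?_) ?_⟩
  · refine hA.2.le ⟨hc, fun k x hx => ?_⟩
    rw [one_mul]
    refine mem_deg_of_proj_eq_zero fun l hl => ?_
    obtain ⟨d, hd, hproj⟩ := exists_mem_centroidDeg_proj hc (l * k⁻¹)
    obtain rfl : d = 0 := by rwa [hC _ (mt mul_inv_eq_one.1 hl)] at hd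
    simpa only [inv_mul_cancel_right, LinearMap.zero_apply] using (hproj k x hx).symm
  · exact (Submodule.span_singleton_le_iff_mem _ _).2 (one_mem A.centroid)

theorem IsTwistedCover.isCentralSimple {K : Type z} [CommGroup K] {φ : G →* K} {τ : Z2sym G Fˣ}
    {B : GradedAlg.{u, v, w} F G} {A : GradedAlg.{u, z, x} F K} {P : B.carrier →ₗ[F] A.carrier}
    (h : IsTwistedCover φ τ B A P) (hφ : Function.Surjective φ) (hB : B.IsGradedCentralSimple)
    (hC : ∀ g, B.centroidDeg g ≠ ⊥ → g ∈ φ.ker) : A.IsCentralSimple := by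
  refine IsGradedCentralSimple.isCentralSimple
    ⟨h.isGradedSimple_base hφ hB.1, le_antisymm (fun c hc => ?_) ?_⟩ fun q hq => ?_
  · obtain ⟨c', hc', hPc⟩ := h.exists_centroid_lift (g := 1) ((map_one φ).symm ▸ hc)
    obtain ⟨r, rfl⟩ := Submodule.mem_span_singleton.1 (hB.2.le hc')
    refine Submodule.mem_span_singleton.2 ⟨(τ.1 1 1 : F)⁻¹ * r, linearMap_ext fun q a ha => ?_⟩
    obtain ⟨k, rfl⟩ := hφ q
    obtain ⟨x, hx, rfl⟩ := (h.bijOn k).surjOn ha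
    have hcx : r • P x = (τ.1 1 k : F) • c (P x) := (map_smul P r x).symm.trans (hPc x hx)
    rw [Z2sym.apply_one_left] at hcx
    change ((τ.1 1 1 : F)⁻¹ * r) • P x = c (P x)
    rw [mul_smul, hcx, inv_smul_smul₀ (Units.ne_zero _)]
  · exact (Submodule.span_singleton_le_iff_mem _ _).2 one_mem_centroidDeg
  · by_contra hne
    obtain ⟨c, hc, hc₀⟩ := (Submodule.ne_bot_iff _).1 hne
    obtain ⟨g, rfl⟩ := hφ q
    obtain ⟨c', hc', hPc⟩ := h.exists_centroid_lift hc
    refine hq (hC g ((Submodule.ne_bot_iff _).2 ⟨c', hc', ?_⟩))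
    rintro rfl
    refine hc₀ (linearMap_ext fun r a ha => ?_)
    obtain ⟨k, rfl⟩ := hφ r
    obtain ⟨x, hx, rfl⟩ := (h.bijOn k).surjOn ha
    have hcx := hPc x hx
    rw [LinearMap.zero_apply, map_zero] at hcx
    exact (smul_eq_zero.1 hcx.symm).resolve_left (Units.ne_zero _)

end Simplicity

/-! ## Loop algebras as covers -/

section Loop

variable {H : Subgroup G} (A : GradedAlg.{u, v, w} F (G ⧸ H))

/-- The projection `L_π(A) → A`, `a ⊗ g ↦ a`. -/
def loopProj : A.loop.carrier →ₗ[F] A.carrier :=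
  (TensorProduct.rid F A.carrier).toLinearMap ∘ₗ
    LinearMap.lTensor A.carrier (MonoidAlgebra.lift F F G (1 : G →* F)).toLinearMap ∘ₗ
      A.loopSpace.subtype

variable {A} in
theorem loopProj_eq {z : A.loop.carrier} {a : A.carrier} {g : G}
    (h : a ⊗ₜ MonoidAlgebra.of F G g = z.1) : A.loopProj z = a := by
  change TensorProduct.rid F A.carrier (LinearMap.lTensor A.carrier
    (MonoidAlgebra.lift F F G (1 : G →* F)).toLinearMap z.1) = a
  rw [← h]
  simp

theorem isTwistedCover_loopProj :
    IsTwistedCover (QuotientGroup.mk' H) 1 A.loop A A.loopProj := by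
  refine ⟨fun g => ⟨?_, ?_, fun a ha => ?_⟩, ?_⟩
  · rintro z ⟨a, ha, hz⟩
    exact (loopProj_eq hz).symm ▸ ha
  · rintro z ⟨a, -, hz⟩ z' ⟨a', -, hz'⟩ h
    rw [loopProj_eq hz, loopProj_eq hz'] at h
    exact Subtype.ext (hz.symm.trans (h ▸ hz'))
  · have hmem : a ⊗ₜ MonoidAlgebra.of F G g ∈ A.loopDeg g := ⟨a, ha, rfl⟩
    exact ⟨⟨_, le_iSup A.loopDeg g hmem⟩, hmem, loopProj_eq rfl⟩
  · rintro g k z z' ⟨a, -, hz⟩ ⟨a', -, hz'⟩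
    rw [loopProj_eq hz, loopProj_eq hz']
    refine (loopProj_eq (g := g * k) ?_).trans (one_smul F _).symm
    change _ = A.tensorMul (A.loopSpace.subtype z) (A.loopSpace.subtype z')
    rw [← hz, ← hz']
    simp [tensorMul]

theorem isTwistedCover_twistedLoop (τ : Z2sym G Fˣ) :
    IsTwistedCover (QuotientGroup.mk' H) τ (A.twistedLoop τ) A A.loopProj := by
  have h := (isTwistedCover_twist τ).comp A.isTwistedCover_loopProj
  rwa [map_one, mul_one, MonoidHom.comp_id] at h

end Loop

theorem isInternal_comap_iSup {V ι : Type*} [AddCommGroup V] [Module F V] [DecidableEq ι]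
    {S : ι → Submodule F V} (hS : iSupIndep S) :
    DirectSum.IsInternal fun i => (S i).comap (⨆ i, S i).subtype := by
  have hle (i : ι) : S i ≤ ⨆ i, S i := le_iSup S i
  have hmap (i : ι) : ((S i).comap (⨆ i, S i).subtype).map (⨆ i, S i).subtype = S i := by
    rw [Submodule.map_comap_subtype, inf_eq_right.2 (hle i)]
  refine DirectSum.isInternal_submodule_of_iSupIndep_of_iSup_eq_top ?_ ?_
  · refine (iSupIndep_map_orderIso_iff (Submodule.mapIic _)).1 (iSupIndep.of_coe_Iic_comp ?_)
    exact hS.mono fun i => (hmap i).le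
  · refine Submodule.map_injective_of_injective (⨆ i, S i).subtype_injective ?_
    simp only [Submodule.map_iSup, hmap, Submodule.map_subtype_top]

/-! ## The quotient by an action in the centroid -/

section Fold

variable {K : Type z} [CommGroup K] {φ : G →* K} {B : GradedAlg.{u, v, w} F G}
  (hφ : Function.Surjective φ) (ρ : φ.ker →* Module.End F B.carrier)

/-- The element of `φ.ker` translating `g` to the chosen representative of its class. -/
def toRepresentative (g : G) : φ.ker :=
  ⟨Function.surjInv hφ (φ g) * g⁻¹, by
    rw [MonoidHom.mem_ker, map_mul, Function.surjInv_eq hφ, map_inv, mul_inv_cancel]⟩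

theorem toRepresentative_mul (g : G) :
    (toRepresentative hφ g : G) * g = Function.surjInv hφ (φ g) :=
  inv_mul_cancel_right _ _

theorem toRepresentative_mul_mul (h : φ.ker) (g : G) :
    toRepresentative hφ (h * g) * h = toRepresentative hφ g := by
  refine Subtype.ext ?_
  change Function.surjInv hφ (φ (h * g)) * (h * g)⁻¹ * h = Function.surjInv hφ (φ g) * g⁻¹
  have hh : φ h = 1 := h.2
  rw [map_mul, hh, one_mul, mul_assoc, mul_inv_rev, inv_mul_cancel_right]

/-- The projection onto the components of representative degree that moves elements by `ρ`. -/
def fold : Module.End F B.carrier :=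
  lift fun g => ρ (toRepresentative hφ g) ∘ₗ (B.deg g).subtype

/-- The subspace spanned by the components of representative degree. -/
def foldSpace (B : GradedAlg.{u, v, w} F G) : Submodule F B.carrier :=
  ⨆ q, B.deg (Function.surjInv hφ q)

theorem fold_of_mem {g : G} {x : B.carrier} (hx : x ∈ B.deg g) :
    fold hφ ρ x = ρ (toRepresentative hφ g) x :=
  lift_of_mem _ hx

variable {ρ} (hρ : ∀ h : φ.ker, ρ h ∈ B.centroidDeg h)

include hρ

theorem bijOn_apply (h : φ.ker) (g : G) : Set.BijOn (ρ h) (B.deg g) (B.deg (h * g)) := by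
  have hinv (k : φ.ker) (x : B.carrier) : ρ k⁻¹ (ρ k x) = x := by
    rw [← Module.End.mul_apply, ← map_mul, inv_mul_cancel, map_one, Module.End.one_apply]
  refine ⟨(hρ h).2 g, (Function.LeftInverse.injective (hinv h)).injOn, fun y hy => ?_⟩
  have hy' := (hρ h⁻¹).2 _ y hy
  rw [Subgroup.coe_inv, inv_mul_cancel_left] at hy'
  exact ⟨ρ h⁻¹ y, hy', by simpa only [inv_inv] using hinv h⁻¹ y⟩

theorem bijOn_fold (g : G) :
    Set.BijOn (fold hφ ρ) (B.deg g) (B.deg (Function.surjInv hφ (φ g))) :=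
  toRepresentative_mul hφ g ▸
    (bijOn_apply hρ (toRepresentative hφ g) g).congr fun _ hx => (fold_of_mem hφ ρ hx).symm

theorem fold_mem_foldSpace (x : B.carrier) : fold hφ ρ x ∈ foldSpace hφ B := by
  induction x using induction_on_homogeneous with
  | zero => simp
  | add x y hx hy => exact map_add (fold hφ ρ) x y ▸ add_mem hx hy
  | homogeneous g x hx => exact Submodule.mem_iSup_of_mem _ ((bijOn_fold hφ hρ g).mapsTo hx)

theorem fold_apply (h : φ.ker) (x : B.carrier) : fold hφ ρ (ρ h x) = fold hφ ρ x := by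
  refine LinearMap.congr_fun (f := fold hφ ρ ∘ₗ ρ h) (linearMap_ext fun g x hx => ?_) x
  rw [LinearMap.comp_apply, fold_of_mem _ _ ((hρ h).2 g x hx), fold_of_mem _ _ hx,
    ← Module.End.mul_apply, ← map_mul, toRepresentative_mul_mul]

theorem fold_mul_fold {g k : G} {x y : B.carrier} (hx : x ∈ B.deg g) (hy : y ∈ B.deg k) :
    fold hφ ρ (B.mul (fold hφ ρ x) (fold hφ ρ y)) = fold hφ ρ (B.mul x y) := by
  rw [fold_of_mem _ _ hx, fold_of_mem _ _ hy, ← ((hρ _).1 _ _).1, fold_apply hφ hρ,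
    ← ((hρ _).1 _ _).2, fold_apply hφ hρ]

open scoped Classical in
/-- The quotient of `B` by the action `ρ` of `φ.ker`, realised on the components of representative
degree. -/
def base : GradedAlg.{u, z, w} F K where
  carrier := foldSpace hφ B
  mul := (B.mul.domRestrict₁₂ _ _).compr₂ ((fold hφ ρ).codRestrict _ (fold_mem_foldSpace hφ hρ))
  deg q := (B.deg (Function.surjInv hφ q)).comap (foldSpace hφ B).subtype
  isInternal := isInternal_comap_iSup <|
    B.isInternal.submodule_iSupIndep.comp (Function.injective_surjInv hφ)
  mul_mem {q r x y} hx hy := by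
    have hxy := (bijOn_fold hφ hρ _).mapsTo (B.mul_mem hx hy)
    rwa [map_mul, Function.surjInv_eq hφ, Function.surjInv_eq hφ] at hxy

theorem isTwistedCover_base : IsTwistedCover φ 1 B (base hφ hρ)
    ((fold hφ ρ).codRestrict _ (fold_mem_foldSpace hφ hρ)) where
  bijOn g := by
    have hbij := bijOn_fold hφ hρ g
    refine ⟨hbij.mapsTo, fun x hx y hy hxy => hbij.injOn hx hy (congrArg Subtype.val hxy),
      fun y hy => ?_⟩
    exact (hbij.surjOn hy).imp fun x hx => ⟨hx.1, Subtype.ext hx.2⟩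
  apply_mul g k x y hx hy :=
    (Subtype.ext (fold_mul_fold hφ hρ hx hy).symm).trans (one_smul F _).symm

end Fold

/-! ## Every graded-central-simple algebra is a twisted loop algebra -/

section Existence

variable {B : GradedAlg.{u, v, w} F G} {N : Subgroup G}

theorem IsGradedCentralSimple.exists_centroid_cocycle (hB : B.IsGradedCentralSimple)
    (hN : N ≤ hB.1.centroidSupport) :
    ∃ (c : N → Module.End F B.carrier) (σ : Z2sym N Fˣ), (∀ h : N, c h ∈ B.centroidDeg h) ∧
      (∀ h, c h ≠ 0) ∧ ∀ h k, c h * c k = (σ.1 h k : F) • c (h * k) := by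
  choose c hc hc₀ using fun h : N => (Submodule.ne_bot_iff _).1 (hN h.2)
  have hinj (h : N) := hB.1.injective_of_mem_centroidDeg (hc h) (hc₀ h)
  have hcc₀ (h k : N) : c h * c k ≠ 0 := by
    obtain ⟨x, hx⟩ := DFunLike.ne_iff.1 (hc₀ k)
    exact DFunLike.ne_iff.2 ⟨x, (map_ne_zero_iff _ (hinj h)).2 hx⟩
  have hunit (h k : N) : ∃ r : Fˣ, c h * c k = (r : F) • c (h * k) := by
    obtain ⟨r, hr⟩ := hB.exists_eq_smul (mul_mem_centroidDeg (hc h) (hc k)) (hc (h * k)) (hc₀ _)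
    refine ⟨Units.mk0 r ?_, hr⟩
    rintro rfl
    exact hcc₀ h k (hr.trans (zero_smul F _))
  choose σ hσ using hunit
  have hcancel {h : N} {r s : Fˣ} (hrs : (r : F) • c h = (s : F) • c h) : r = s :=
    Units.ext (smul_left_injective F (hc₀ h) hrs)
  refine ⟨c, ⟨σ, fun h k l => hcancel (h := h * k * l) ?_, fun h k => hcancel (h := h * k) ?_⟩,
    hc, hc₀, hσ⟩
  · rw [Units.val_mul, mul_smul, ← hσ, ← smul_mul_assoc, ← hσ, mul_assoc, hσ k, mul_smul_comm,
      hσ, smul_smul, Units.val_mul, mul_comm (σ k l : F), mul_assoc]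
  · rw [← hσ, mul_comm_of_mem_centroid hB.1.2.1 (hc h).1 (hc k).1, hσ, mul_comm]

/-- Twisting by `τ⁻¹` turns a projective action in the centroid with cocycle `τ` into an action. -/
theorem IsTwistedCover.exists_monoidHom_centroid {τ : Z2sym G Fˣ} {B' : GradedAlg.{u, v, x} F G}
    {Q : B'.carrier →ₗ[F] B.carrier} (h : IsTwistedCover (MonoidHom.id G) τ⁻¹ B' B Q)
    {c : N → Module.End F B.carrier} (hc : ∀ h : N, c h ∈ B.centroidDeg h)
    (hinj : ∀ h, Function.Injective (c h))
    (hmul : ∀ h k : N, c h * c k = (τ.1 h k : F) • c (h * k)) :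
    ∃ ρ : N →* Module.End F B'.carrier, ∀ h : N, ρ h ∈ B'.centroidDeg h := by
  choose ρ hρ hQρ using fun k : N => h.exists_centroid_lift (hc k)
  have hcc (k l : N) (a : B.carrier) : c k (c l a) = (τ.1 k l : F) • c (k * l) a :=
    LinearMap.congr_fun (hmul k l) a
  have hone (a : B.carrier) : c 1 a = (τ.1 1 1 : F) • a := hinj 1 <| by
    rw [hcc, map_smul, one_mul]
    rfl
  refine ⟨⟨⟨ρ, linearMap_ext fun g x hx => ?_⟩, fun k l => linearMap_ext fun g x hx => ?_⟩, hρ⟩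
  · refine (h.bijOn g).injOn (one_mul g ▸ (hρ 1).2 g x hx) hx ?_
    have hτ : (τ⁻¹).1 1 g = (τ.1 1 1)⁻¹ :=
      congrArg Inv.inv (Z2sym.apply_one_left τ g)
    rw [hQρ 1 x hx, hone]
    change ((τ⁻¹).1 1 g : F) • (τ.1 1 1 : F) • Q x = Q x
    rw [hτ]
    exact inv_smul_smul (τ.1 1 1) (Q x)
  · have hlx := (hρ l).2 g x hx
    refine (h.bijOn _).injOn ((hρ (k * l)).2 g x hx)
      ((mul_assoc (k : G) l g).symm ▸ (hρ k).2 _ _ hlx) ?_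
    have hτ : (τ⁻¹).1 k (l * g) * (τ⁻¹).1 l g * τ.1 k l = (τ⁻¹).1 (k * l : G) g := by
      rw [← Z2sym.cocycle]
      exact inv_mul_cancel_comm _ _
    rw [Module.End.mul_apply, hQρ k _ hlx, hQρ l x hx, hQρ _ x hx, map_smul, hcc, smul_smul,
      smul_smul, ← Units.val_mul, ← Units.val_mul]
    exact congrArg (fun r : Fˣ => (r : F) • c (k * l) (Q x)) hτ.symm

theorem IsGradedCentralSimple.exists_isTwistedCover (hB : B.IsGradedCentralSimple) :
    ∃ (H : Subgroup G) (τ : Z2sym G Fˣ) (A : GradedAlg.{u, v, w} F (G ⧸ H))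
      (P : B.carrier →ₗ[F] A.carrier),
      IsTwistedCover (QuotientGroup.mk' H) τ B A P ∧ A.IsCentralSimple := by
  let H := hB.1.centroidSupport
  have hker : (QuotientGroup.mk' H).ker = H := QuotientGroup.ker_mk' H
  have hφ := QuotientGroup.mk'_surjective H
  obtain ⟨c, σ, hc, hc₀, hcσ⟩ := hB.exists_centroid_cocycle hker.le
  obtain ⟨τ, rfl⟩ := Z2sym.comap_subtype_surjective (QuotientGroup.mk' H).ker σ
  obtain ⟨ρ, hρ⟩ := (isTwistedCover_twist (B := B) τ⁻¹).exists_monoidHom_centroid hc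
    (fun h => hB.1.injective_of_mem_centroidDeg (hc h) (hc₀ h)) hcσ
  have hcover := (isTwistedCover_inv_twist τ⁻¹).comp (isTwistedCover_base hφ hρ)
  rw [inv_inv, map_one, mul_one, MonoidHom.comp_id] at hcover
  exact ⟨H, τ, _, _, hcover, hcover.isCentralSimple hφ hB fun g hg => hker.ge hg⟩

end Existence

/-! ## Uniqueness of the base -/

namespace IsTwistedCover

variable {K : Type z} [CommGroup K]
  {φ : G →* K} {τ₁ τ₂ : Z2sym G Fˣ} {B B₁ B₂ : GradedAlg.{u, v, w} F G}
  {A₁ A₂ : GradedAlg.{u, z, x} F K} {P₁ : B.carrier →ₗ[F] A₁.carrier}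
  {P₂ : B.carrier →ₗ[F] A₂.carrier}

theorem exists_shift_eq_smul_shift (hB : B.IsGradedCentralSimple)
    (h₁ : IsTwistedCover φ τ₁ B A₁ P₁) (h₂ : IsTwistedCover φ τ₂ B A₂ P₂) :
    ∃ m : φ.ker → Fˣ, (∀ g, h₁.shift g = (m g : F) • h₂.shift g) ∧
      Z2sym.comap Fˣ φ.ker.subtype (τ₁ * τ₂⁻¹) = Z2sym.coboundary m := by
  have := hB.1.1
  have hunit (g : φ.ker) : ∃ r : Fˣ, h₁.shift g = (r : F) • h₂.shift g := by
    obtain ⟨r, hr⟩ := hB.exists_eq_smul (h₁.shift_mem g) (h₂.shift_mem g) (h₂.shift_ne_zero g)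
    refine ⟨Units.mk0 r ?_, hr⟩
    rintro rfl
    exact h₁.shift_ne_zero g (hr.trans (zero_smul F _))
  choose m hm using hunit
  refine ⟨m, hm, Subtype.ext (funext₂ fun g k => ?_)⟩
  have hmul : τ₁.1 g k * m (g * k) = m g * m k * τ₂.1 g k := by
    refine Units.ext (smul_left_injective F (h₂.shift_ne_zero (g * k)) ?_)
    simp only [Units.val_mul, mul_smul, ← hm, ← h₁.shift_mul_shift, ← h₂.shift_mul_shift]
    rw [hm g, hm k, smul_mul_smul_comm, mul_smul]
  rw [Z2sym.coboundary_apply, eq_mul_inv_iff_mul_eq]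
  change τ₁.1 g k * (τ₂.1 g k)⁻¹ * m (g * k) = m g * m k
  rw [mul_right_comm, hmul, mul_inv_cancel_right]

theorem of_comp {ρ : Z2sym K Fˣ} {f : A₁.carrier →ₗ[F] A₂.carrier} (hφ : Function.Surjective φ)
    (h₁ : IsTwistedCover φ τ₁ B A₁ P₁)
    (h : IsTwistedCover φ (τ₁ * Z2sym.comap Fˣ φ ρ) B A₂ (f ∘ₗ P₁)) :
    IsTwistedCover (MonoidHom.id K) ρ A₁ A₂ f where
  bijOn q := by
    obtain ⟨g, rfl⟩ := hφ q
    have hbij := (Set.bijOn_comp_iff (h₁.bijOn g).injOn).1 (h.bijOn g)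
    rwa [(h₁.bijOn g).image_eq] at hbij
  apply_mul q r a b ha hb := by
    obtain ⟨g, rfl⟩ := hφ q
    obtain ⟨k, rfl⟩ := hφ r
    obtain ⟨x, hx, rfl⟩ := (h₁.bijOn g).surjOn ha
    obtain ⟨y, hy, rfl⟩ := (h₁.bijOn k).surjOn hb
    refine smul_right_injective _ (τ₁.1 g k).ne_zero ?_
    beta_reduce
    rw [← map_smul, ← h₁.apply_mul hx hy, smul_smul, ← Units.val_mul]
    exact h.apply_mul hx hy

theorem twist_gradedIso {μ : Z2sym K Fˣ} (hφ : Function.Surjective φ)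
    (h₁ : IsTwistedCover φ τ₁ B A₁ P₁) (h₂ : IsTwistedCover φ τ₂ B A₂ P₂)
    (hτ : τ₁ = Z2sym.comap Fˣ φ μ * τ₂)
    (hshift : ∀ g : φ.ker, ∀ k, ∀ x ∈ B.deg k, P₂ (h₁.shift g x) = (τ₁.1 g k : F) • P₂ x) :
    (A₁.twist μ).GradedIso A₂ := by
  obtain ⟨f, hf⟩ := h₁.exists_descent_of_apply_shift hφ P₂ hshift
  obtain rfl : f ∘ₗ P₁ = P₂ := LinearMap.ext hf
  have hf' : IsTwistedCover (MonoidHom.id K) μ⁻¹ A₁ A₂ f := h₁.of_comp hφ <| by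
    rwa [hτ, map_inv, mul_inv_cancel_comm]
  have hiso := (isTwistedCover_twist μ).comp hf'
  rw [MonoidHom.comp_id, Z2sym.comap_id, mul_inv_cancel] at hiso
  exact hiso.gradedIso

/-- The function comparing the shifts of the two covers extends to `γ : G → Fˣ`. Rescaling `B` by
`γ⁻¹` turns the shifts of the first cover into those of the second, up to the twists. -/
theorem exists_twist_gradedIso (hφ : Function.Surjective φ) (hB : B.IsGradedCentralSimple)
    (h₁ : IsTwistedCover φ τ₁ B A₁ P₁) (h₂ : IsTwistedCover φ τ₂ B A₂ P₂) :
    ∃ (γ : G → Fˣ) (μ : Z2sym K Fˣ),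
      τ₁ = Z2sym.coboundary γ * (Z2sym.comap Fˣ φ μ * τ₂) ∧ (A₁.twist μ).GradedIso A₂ := by
  obtain ⟨m, hm, hmτ⟩ := exists_shift_eq_smul_shift hB h₁ h₂
  obtain ⟨γ, hγm, hγ⟩ := Z2sym.exists_extend_coboundary (τ₁ * τ₂⁻¹) m hmτ
  obtain ⟨μ, hμ⟩ := Z2sym.exists_comap_eq hφ (τ₁ * τ₂⁻¹ * (Z2sym.coboundary γ)⁻¹)
    fun g h hh => mul_inv_eq_one.2 (hγ g ⟨h, hh⟩)
  have hτ : τ₁ = Z2sym.comap Fˣ φ μ * (Z2sym.coboundary γ * τ₂) := by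
    rw [hμ, mul_assoc, inv_mul_cancel_left, inv_mul_cancel_right]
  have h₂' := (isTwistedCover_scale γ⁻¹).comp h₂
  rw [map_inv, inv_inv, MonoidHom.comp_id, Z2sym.comap_id] at h₂'
  refine ⟨γ, μ, hτ.trans (mul_left_comm _ _ _), twist_gradedIso hφ h₁ h₂' hτ fun g k x hx => ?_⟩
  have hγτ : (γ (g * k))⁻¹ * (m g * τ₂.1 g k) = τ₁.1 g k * (γ k)⁻¹ := by
    have hd : τ₁.1 k g * (τ₂.1 k g)⁻¹ = γ k * γ g * (γ (k * g))⁻¹ := hγ k g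
    rw [Z2sym.symm τ₁, eq_mul_inv_iff_mul_eq, mul_inv_eq_iff_eq_mul.1 hd, Z2sym.symm τ₂, hγm,
      mul_comm (g : G) k]
    grind [mul_inv_cancel (γ (k * g))]
  rw [LinearMap.comp_apply, LinearMap.comp_apply, scale_of_mem _ ((h₁.shift_mem g).2 k x hx),
    scale_of_mem _ hx, map_smul, map_smul, hm, LinearMap.smul_apply, map_smul,
    h₂.apply_shift g hx]
  simpa only [smul_smul, ← Units.val_mul, Pi.inv_apply] using
    congrArg (fun r : Fˣ => (r : F) • P₂ x) hγτ

theorem gradedIso_iff_exists_twist_gradedIso (hφ : Function.Surjective φ)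
    (hB : B₁.IsGradedCentralSimple) {P₁ : B₁.carrier →ₗ[F] A₁.carrier}
    {P₂ : B₂.carrier →ₗ[F] A₂.carrier} (h₁ : IsTwistedCover φ τ₁ B₁ A₁ P₁)
    (h₂ : IsTwistedCover φ τ₂ B₂ A₂ P₂) :
    B₁.GradedIso B₂ ↔ ∃ (γ : G → Fˣ) (μ : Z2sym K Fˣ),
      τ₁ = Z2sym.coboundary γ * (Z2sym.comap Fˣ φ μ * τ₂) ∧ (A₁.twist μ).GradedIso A₂ := by
  refine ⟨fun h => ?_, ?_⟩
  · obtain ⟨e, he⟩ := h.exists_isTwistedCover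
    have he₂ := he.comp h₂
    rw [one_mul, MonoidHom.comp_id] at he₂
    exact exists_twist_gradedIso hφ hB h₁ he₂
  · rintro ⟨γ, μ, rfl, hA⟩
    obtain ⟨e, he⟩ := hA.exists_isTwistedCover
    have h := ((isTwistedCover_scale γ).comp h₁).comp ((isTwistedCover_inv_twist μ).comp he)
    have hτ : (Z2sym.coboundary γ)⁻¹ * Z2sym.comap Fˣ (MonoidHom.id G)
        (Z2sym.coboundary γ * (Z2sym.comap Fˣ φ μ * τ₂)) *
        Z2sym.comap Fˣ (φ.comp (MonoidHom.id G)) (μ⁻¹ * Z2sym.comap Fˣ (MonoidHom.id K) 1) =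
        τ₂ := by
      rw [map_one, mul_one, map_inv, MonoidHom.comp_id, Z2sym.comap_id, inv_mul_cancel_left,
        mul_inv_cancel_comm]
    rw [hτ] at h
    exact h₂.gradedIso_of_cover h

end IsTwistedCover

end GradedAlg

/-! ## The classification -/

section Cohomology

variable {A M : Type*} [CommGroup A] [CommGroup M]

theorem H2sym.mk_surjective : Function.Surjective (H2sym.mk : Z2sym A M →* H2sym A M) :=
  QuotientGroup.mk'_surjective _

theorem H2sym.mk_eq_mk_iff {σ τ : Z2sym A M} :
    H2sym.mk σ = H2sym.mk τ ↔ ∃ γ : A → M, σ = Z2sym.coboundary γ * τ := by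
  have h : H2sym.mk σ = H2sym.mk τ ↔ σ / τ ∈ (B2 A M).subgroupOf (Z2sym A M) :=
    QuotientGroup.eq_iff_div_mem
  rw [h]
  refine exists_congr fun γ => ?_
  rw [← div_eq_iff_eq_mul, eq_comm, Subtype.ext_iff]
  rfl

theorem H2sym.pullback_subtype_pullback_mk' (H : Subgroup A) (c : H2sym (A ⧸ H) M) :
    H2sym.pullback M H.subtype (H2sym.pullback M (QuotientGroup.mk' H) c) = 1 := by
  obtain ⟨μ, rfl⟩ := H2sym.mk_surjective c
  rw [← map_one H2sym.mk]
  refine H2sym.mk_eq_mk_iff.2 ⟨fun _ => μ.1 1 1, Subtype.ext (funext₂ fun a b => ?_)⟩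
  change μ.1 ((a : A) : A ⧸ H) ((b : A) : A ⧸ H) = μ.1 1 1 * μ.1 1 1 * (μ.1 1 1)⁻¹ * 1
  rw [(QuotientGroup.eq_one_iff (a : A)).2 a.2, (QuotientGroup.eq_one_iff (b : A)).2 b.2,
    mul_inv_cancel_right, mul_one]

end Cohomology

section Classification

open GradedAlg

variable {F : Type u} [Field F] {G : Type v} [CommGroup G]

theorem LoopTriple.rel_mk_iff {H : Subgroup G} {τ₁ τ₂ : Z2sym G Fˣ}
    {A₁ A₂ : GradedAlg.{u, v, max u v w} F (G ⧸ H)} (hA₁ : A₁.IsCentralSimple)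
    (hA₂ : A₂.IsCentralSimple) :
    LoopTriple.Rel.{u, v, w} ⟨H, H2sym.mk τ₁, A₁, hA₁⟩ ⟨H, H2sym.mk τ₂, A₂, hA₂⟩ ↔
      ∃ (γ : G → Fˣ) (μ : Z2sym (G ⧸ H) Fˣ),
        τ₁ = Z2sym.coboundary γ * (Z2sym.comap Fˣ (QuotientGroup.mk' H) μ * τ₂) ∧
          (A₁.twist μ).GradedIso A₂ := by
  have hmk (μ : Z2sym (G ⧸ H) Fˣ) :
      H2sym.mk τ₁ = H2sym.pullback Fˣ (QuotientGroup.mk' H) (H2sym.mk μ) * H2sym.mk τ₂ ↔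
        ∃ γ, τ₁ = Z2sym.coboundary γ * (Z2sym.comap Fˣ (QuotientGroup.mk' H) μ * τ₂) :=
    H2sym.mk_eq_mk_iff (τ := Z2sym.comap Fˣ (QuotientGroup.mk' H) μ * τ₂)
  constructor
  · rintro ⟨_, _, _, _, _, _, _, ⟨⟩, ⟨⟩, -, μ, hμ, hA⟩
    obtain ⟨γ, hγ⟩ := (hmk μ).1 hμ
    exact ⟨γ, μ, hγ, hA⟩
  · rintro ⟨γ, μ, hγ, hA⟩
    have hμ := (hmk μ).2 ⟨γ, hγ⟩
    refine ⟨H, _, _, A₁, A₂, hA₁, hA₂, rfl, rfl, ?_, μ, hμ, hA⟩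
    rw [hμ, map_mul, H2sym.pullback_subtype_pullback_mk', one_mul]

theorem GradedAlg.IsCentralSimple.isGradedCentralSimple_twistedLoop {H : Subgroup G}
    {A : GradedAlg.{u, v, w} F (G ⧸ H)} (hA : A.IsCentralSimple) (τ : Z2sym G Fˣ) :
    (A.twistedLoop τ).IsGradedCentralSimple :=
  (isTwistedCover_twistedLoop A τ).isGradedCentralSimple (QuotientGroup.mk'_surjective H) hA

/-- The kernel of the covering is the support of the centroid. -/
theorem GradedAlg.GradedIso.eq_of_twistedLoop {H₁ H₂ : Subgroup G} {τ₁ τ₂ : Z2sym G Fˣ}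
    {A₁ : GradedAlg.{u, v, w} F (G ⧸ H₁)} {A₂ : GradedAlg.{u, v, w} F (G ⧸ H₂)}
    (hA₁ : A₁.IsCentralSimple) (hA₂ : A₂.IsCentralSimple)
    (h : (A₁.twistedLoop τ₁).GradedIso (A₂.twistedLoop τ₂)) : H₁ = H₂ := by
  obtain ⟨e, he⟩ := h.exists_isTwistedCover
  have h₂ := he.comp (isTwistedCover_twistedLoop A₂ τ₂)
  ext g
  rw [← QuotientGroup.ker_mk' H₁, ← QuotientGroup.ker_mk' H₂]
  exact ((isTwistedCover_twistedLoop A₁ τ₁).centroidDeg_ne_bot_iff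
    (QuotientGroup.mk'_surjective H₁) hA₁).symm.trans
      (h₂.centroidDeg_ne_bot_iff (QuotientGroup.mk'_surjective H₂) hA₂)

theorem LoopTriple.rel_iff_gradedIso {H₁ H₂ : Subgroup G} {τ₁ τ₂ : Z2sym G Fˣ}
    {A₁ : GradedAlg.{u, v, max u v w} F (G ⧸ H₁)} {A₂ : GradedAlg.{u, v, max u v w} F (G ⧸ H₂)}
    (hA₁ : A₁.IsCentralSimple) (hA₂ : A₂.IsCentralSimple) :
    LoopTriple.Rel.{u, v, w} ⟨H₁, H2sym.mk τ₁, A₁, hA₁⟩ ⟨H₂, H2sym.mk τ₂, A₂, hA₂⟩ ↔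
      (A₁.twistedLoop τ₁).GradedIso (A₂.twistedLoop τ₂) := by
  have hiff {H : Subgroup G} {A₁ A₂ : GradedAlg.{u, v, max u v w} F (G ⧸ H)}
      (hA₁ : A₁.IsCentralSimple) (hA₂ : A₂.IsCentralSimple) :
      LoopTriple.Rel.{u, v, w} ⟨H, H2sym.mk τ₁, A₁, hA₁⟩ ⟨H, H2sym.mk τ₂, A₂, hA₂⟩ ↔
        (A₁.twistedLoop τ₁).GradedIso (A₂.twistedLoop τ₂) :=
    (rel_mk_iff hA₁ hA₂).trans <| (IsTwistedCover.gradedIso_iff_exists_twist_gradedIso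
      (QuotientGroup.mk'_surjective H) (hA₁.isGradedCentralSimple_twistedLoop τ₁)
      (isTwistedCover_twistedLoop A₁ τ₁) (isTwistedCover_twistedLoop A₂ τ₂)).symm
  constructor
  · intro h
    obtain rfl : H₁ = H₂ := by
      obtain ⟨_, _, _, _, _, _, _, ⟨⟩, ⟨⟩, -⟩ := h
      rfl
    exact (hiff hA₁ hA₂).1 h
  · intro h
    obtain rfl := h.eq_of_twistedLoop hA₁ hA₂
    exact (hiff hA₁ hA₂).2 h

theorem LoopTriple.exists_eq_mk (t : LoopTriple.{u, v, w} F G) :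
    ∃ τ : Z2sym G Fˣ, t = ⟨t.H, H2sym.mk τ, t.A, t.centralSimple⟩ := by
  obtain ⟨τ, hτ⟩ := H2sym.mk_surjective t.τ
  exact ⟨τ, by rw [hτ]⟩

/-- The algebra `L_π^τ(A)` of a triple `(H, [τ], A)`, for a chosen representative `τ` of its
class. -/
def LoopTriple.loopAlg (t : LoopTriple.{u, v, w} F G) : GradedCentralSimpleAlg.{u, v, w} F G :=
  ⟨t.A.twistedLoop t.exists_eq_mk.choose, t.centralSimple.isGradedCentralSimple_twistedLoop _⟩

theorem LoopTriple.rel_iff_loopAlg {t₁ t₂ : LoopTriple.{u, v, w} F G} :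
    t₁.Rel t₂ ↔ t₁.loopAlg.B.GradedIso t₂.loopAlg.B := by
  conv_lhs => rw [t₁.exists_eq_mk.choose_spec, t₂.exists_eq_mk.choose_spec]
  exact rel_iff_gradedIso _ _

/-- The map `[(H, [τ], A)] ↦ [L_π^τ(A)]`. -/
def TripleClasses.loop : TripleClasses.{u, v, w} F G → AlgClasses.{u, v, w} F G :=
  Quotient.map LoopTriple.loopAlg fun _ _ => LoopTriple.rel_iff_loopAlg.1

theorem TripleClasses.loop_toClass {H : Subgroup G} (τ : Z2sym G Fˣ)
    {A : GradedAlg.{u, v, max u v w} F (G ⧸ H)} (hA : A.IsCentralSimple) :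
    TripleClasses.loop (LoopTriple.toClass ⟨H, H2sym.mk τ, A, hA⟩) =
      GradedCentralSimpleAlg.toClass
        ⟨A.twistedLoop τ, hA.isGradedCentralSimple_twistedLoop τ⟩ := by
  refine Quotient.sound ((LoopTriple.rel_iff_gradedIso hA hA).1 ?_)
  rw [← LoopTriple.exists_eq_mk ⟨H, H2sym.mk τ, A, hA⟩ |>.choose_spec]
  exact LoopTriple.rel_equivalence.refl _

theorem TripleClasses.loop_injective :
    Function.Injective (TripleClasses.loop.{u, v, w} (F := F) (G := G)) := by
  rintro ⟨t₁⟩ ⟨t₂⟩ h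
  exact Quotient.sound (LoopTriple.rel_iff_loopAlg.2 (Quotient.exact h))

theorem TripleClasses.loop_surjective :
    Function.Surjective (TripleClasses.loop.{u, v, w} (F := F) (G := G)) := by
  rintro ⟨B, hB⟩
  obtain ⟨H, τ, A, P, hP, hA⟩ := hB.exists_isTwistedCover
  exact ⟨_, (loop_toClass.{u, v, w} τ hA).trans <|
    Quotient.sound (hP.gradedIso_of_cover (isTwistedCover_twistedLoop A τ))⟩

end Classification

end

theorem corollary4p4 (F : Type u) [Field F] (G : Type v) [CommGroup G] :
    ∃ Φ : TripleClasses.{u, v, w} F G → AlgClasses.{u, v, w} F G,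
      (∀ (H : Subgroup G) (τ : Z2sym G Fˣ) (A : GradedAlg.{u, v, max u v w} F (G ⧸ H))
          (hA : A.IsCentralSimple),
        ∃ hL : (A.twistedLoop τ).IsGradedCentralSimple,
          Φ (LoopTriple.toClass ⟨H, H2sym.mk τ, A, hA⟩) =
            GradedCentralSimpleAlg.toClass ⟨A.twistedLoop τ, hL⟩) ∧
      Function.Bijective Φ :=
  ⟨TripleClasses.loop, fun _ τ _ hA => ⟨_, TripleClasses.loop_toClass τ hA⟩,
    TripleClasses.loop_injective, TripleClasses.loop_surjective⟩
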